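/- **Setting.** Let $(M_p)_{p\in\mathbb N}$, $\mathbb N=\{0,1,2,\dots\}$, be a sequence of positive numbers with $M_0=1$ such that * (M.1) $M_p^2\le M_{p-1}M_{p+1}$ for $p\ge 1$; * (M.2) there are $c,H\ge 1$ with $M_p\le cH^p\min_{0\le q\le p}M_{p-q}M_q$ for $p\ge 0$; * (M.3) there is $c\ge1$ with $\sum_{j=p+1}^{\infty}M_{j-1}/M_j\le c\,p\,M_p/M_{p+1}$ (in particular the series converges) for $p\ge 1$. Put $M(\rho)=\sup_{p\in\mathbb N}\ln_+(\rho^p/M_p)$ for $\rho\ge 0$. Let $\Omega\subseteq\mathbb R^d$ be open. For $K\subset\Omega$ compact and $h>0$ put $$\|f\|_{K,h}=\sup_{x\in K,\ \alpha\in\mathbb N^d}\frac{|\partial^\alpha f(x)|}{h^{|\alpha|}M_{|\alpha|}} .$$ Let $\mathcal E^{(M_p)}(\Omega)$ be the space of $f\in C^\infty(\Omega;\mathbb C)$ with $\|f\|_{K,h}<\infty$ for all compact $K\subset\Omega$ and all $h>0$. Let $\mathcal D^{(M_p)}(\Omega)$ be the subspace of those $f$ with compact support in $\Omega$, and $\mathcal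 D^{(M_p)}(K)$ the subspace of those with support in $K$. A Beurling ultradistribution $T\in\mathcal D'^{(M_p)}(\Omega)$ is a linear form on $\mathcal D^{(M_p)}(\Omega)$ such that for every compact $K\subset\Omega$ there are $h>0$ and $C\ge 0$ with $|\langle T,\varphi\rangle|\le C\|\varphi\|_{K,h}$ for all $\varphi\in\mathcal D^{(M_p)}(K)$. Nets are indexed by $\varepsilon\in(0,1)$, and $O(\cdot)$ refers to $\varepsilon\to0$. Let $\mathcal E_M^{(M_p)}(\Omega)$ be the space of nets $(g_\varepsilon)$ in $\mathcal E^{(M_p)}(\Omega)$ such that for all compact $K\subset\Omega$ and $h>0$ there is $k\ge0$ with $\|g_\varepsilon\|_{K,h}=O(e^{M(k/\varepsilon)})$. Let $\mathcal N^{(M_p)}(\Omega)$ be the space of nets in $\mathcal E^{(M_p)}(\Omega)$ such that $\|g_\varepsilon\|_{K,h}=O(e^{-M(k/\varepsilon)})$ for all compact $K\subset\Omega$, $h>0$ and $k\ge0$. Put $\mathcal G^{(M_p)}(\Omega)=\mathcal E_M^{(M_p)}(\Omega)/\mathcal N^{(M_p)}(\Omega)$, and write $[(g_\varepsilon)]$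 for the class of $(g_\varepsilon)$. * An element $g\in\mathcal G^{(M_p)}(\Omega)$ is *regular*, $g\in\mathcal G^{\infty,(M_p)}(\Omega)$, if it has a representative $(g_\varepsilon)$ such that for every compact $K\subset\Omega$ there is $k>0$ such that $\|g_\varepsilon\|_{K,h}=O(e^{M(k/\varepsilon)})$ for every $h>0$. * An element $g=[(g_\varepsilon)]\in\mathcal G^{(M_p)}(\Omega)$ is *strongly $B$-associated* to $T\in\mathcal D'^{(M_p)}(\Omega)$ if for every compact $K\subset\Omega$ there is $b>0$ such that, for every $\varphi\in\mathcal D^{(M_p)}(K)$, $$\Bigl|\int_\Omega g_\varepsilon\varphi\,dx-\langle T,\varphi\rangle\Bigr|=O\bigl(e^{-M(b/\varepsilon)}\bigr).$$ This does not depend on the representative. **Theorem.** If $g\in\mathcal G^{\infty,(M_p)}(\Omega)$ is strongly $B$-associated to $T\in\mathcal D'^{(M_p)}(\Omega)$, then $T\in\mathcal E^{(M_p)}(\Omega)$, that is, there is $f\in\mathcal E^{(M_p)}(\Omega)$ with $\langle T,\varphi\rangle=\int_\Omega f\varphi\,dx$ for all $\varphi\in\mathcal D^{(M_p)}(\Omega)$.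 -/

import Mathlib

open scoped ENNReal ContDiff Topology
open MeasureTheory

noncomputable section

/-- The Euclidean space `ℝ^d`. -/
abbrev RSpace (d : ℕ) : Type := EuclideanSpace ℝ (Fin d)

/-- Weight sequences `(M_p)`: positive, `M_0 = 1`, with (M.1), (M.2) and (M.3). -/
structure WeightSequence where
  /-- The term `M_p`. -/
  seq : ℕ → ℝ
  pos : ∀ p, 0 < seq p
  zero : seq 0 = 1
  /-- (M.1): logarithmic convexity. -/
  logConvex : ∀ p : ℕ, 1 ≤ p → seq p ^ 2 ≤ seq (p - 1) * seq (p + 1)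
  /-- (M.2): stability under ultradifferential operators. -/
  stable : ∃ c H : ℝ, 1 ≤ c ∧ 1 ≤ H ∧
    ∀ p q : ℕ, q ≤ p → seq p ≤ c * H ^ p * (seq (p - q) * seq q)
  /-- (M.3), convergence of the series `∑_j M_{j-1} / M_j`. -/
  summable : Summable fun j : ℕ => seq j / seq (j + 1)
  /-- (M.3), strong non-quasianalyticity; the summation index is `j = p + 1 + i`. -/
  strongNQ : ∃ c : ℝ, 1 ≤ c ∧
    ∀ p : ℕ, 1 ≤ p → ∑' i : ℕ, seq (p + i) / seq (p + i + 1) ≤ c * p * seq p / seq (p + 1)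

/-- The associated function `M(ρ) = sup_p ln_+ (ρ^p / M_p)`. -/
def WeightSequence.assoc (M : WeightSequence) (ρ : ℝ) : ℝ :=
  ⨆ p : ℕ, Real.posLog (ρ ^ p / M.seq p)

/-- The supremum in the definition of the associated function is finite. -/
theorem WeightSequence.assoc_bddAbove (M : WeightSequence) {ρ : ℝ} (hρ : 0 ≤ ρ) :
    BddAbove (Set.range fun p : ℕ => Real.posLog (ρ ^ p / M.seq p)) := by
  have hpos : ∀ p, 0 ≤ ρ ^ p / M.seq p := fun p => div_nonneg (pow_nonneg hρ p) (M.pos p).le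
  have ht : Filter.Tendsto (fun p => ρ * (M.seq p / M.seq (p + 1))) Filter.atTop (𝓝 (ρ * 0)) :=
    M.summable.tendsto_atTop_zero.const_mul ρ
  rw [mul_zero] at ht
  obtain ⟨N, hN⟩ := Filter.eventually_atTop.1 (ht.eventually (gt_mem_nhds one_pos))
  have hstep : ∀ n, ρ ^ (N + n) / M.seq (N + n) ≤ ρ ^ N / M.seq N := by
    intro n
    induction n with
    | zero => simp
    | succ n ih =>
      have h1 : ρ ^ (N + (n + 1)) / M.seq (N + (n + 1))
          = (ρ ^ (N + n) / M.seq (N + n)) * (ρ * (M.seq (N + n) / M.seq (N + n + 1))) := by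
        have a := (M.pos (N + n)).ne'
        have b := (M.pos (N + n + 1)).ne'
        rw [← add_assoc]
        field_simp
        ring
      rw [h1]
      have h2 := (hN (N + n) (Nat.le_add_right _ _)).le
      exact (mul_le_of_le_one_right (hpos _) h2).trans ih
  refine ⟨∑ p ∈ Finset.range (N + 1), Real.posLog (ρ ^ p / M.seq p), ?_⟩
  rintro _ ⟨p, rfl⟩
  rcases Nat.lt_or_ge p (N + 1) with h | h
  · exact Finset.single_le_sum (f := fun p => Real.posLog (ρ ^ p / M.seq p))
      (fun i _ => Real.posLog_nonneg) (Finset.mem_range.2 h)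
  · obtain ⟨n, rfl⟩ := Nat.exists_eq_add_of_le (Nat.le_of_succ_le h)
    refine (Real.posLog_le_posLog (hpos _) (hstep n)).trans ?_
    exact Finset.single_le_sum (f := fun p => Real.posLog (ρ ^ p / M.seq p))
      (fun i _ => Real.posLog_nonneg) (Finset.mem_range.2 (Nat.lt_succ_self N))

theorem WeightSequence.assoc_mono (M : WeightSequence) {ρ σ : ℝ} (hρ : 0 ≤ ρ) (h : ρ ≤ σ) :
    M.assoc ρ ≤ M.assoc σ := by
  refine ciSup_mono (M.assoc_bddAbove (hρ.trans h)) fun p => ?_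
  refine Real.posLog_le_posLog (div_nonneg (pow_nonneg hρ p) (M.pos p).le) ?_
  exact div_le_div_of_nonneg_right (pow_le_pow_left₀ hρ h p) (M.pos p).le

/-- The partial derivative `∂^α f (x)`: the derivative of order `|α|` in the directions of the
basis vectors, `e_j` being taken `α_j` times. -/
def mderiv {d : ℕ} (α : Fin d → ℕ) (f : RSpace d → ℂ) (x : RSpace d) : ℂ :=
  iteratedFDeriv ℝ (∑ j, α j) f x
    fun i => EuclideanSpace.single (finSigmaFinEquiv.symm i).1 (1 : ℝ)

/-- `‖f‖_{K,h} = sup_{x ∈ K, α ∈ ℕ^d} |∂^α f (x)| / (h^|α| M_|α|)`, with values in `[0, ∞]`. -/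
def unorm {d : ℕ} (M : WeightSequence) (K : Set (RSpace d)) (h : ℝ) (f : RSpace d → ℂ) : ℝ≥0∞ :=
  ⨆ x ∈ K, ⨆ α : Fin d → ℕ, ‖mderiv α f x‖ₑ / ENNReal.ofReal (h ^ (∑ j, α j) * M.seq (∑ j, α j))

section

variable {d : ℕ} {M : WeightSequence} {Ω : TopologicalSpace.Opens (RSpace d)}
  {K : Set (RSpace d)} {h : ℝ} {f g : RSpace d → ℂ}

theorem contDiffAt_of_subset (hK : K ⊆ Ω) (hf : ContDiffOn ℝ ∞ f Ω) {x : RSpace d} (hx : x ∈ K)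
    (n : ℕ) : ContDiffAt ℝ n f x :=
  (hf.contDiffAt (Ω.isOpen.mem_nhds (hK hx))).of_le (by exact_mod_cast le_top)

theorem unorm_add_le (hK : K ⊆ Ω) (hf : ContDiffOn ℝ ∞ f Ω) (hg : ContDiffOn ℝ ∞ g Ω) :
    unorm M K h (f + g) ≤ unorm M K h f + unorm M K h g := by
  refine iSup₂_le fun x hx => iSup_le fun α => ?_
  have e : mderiv α (f + g) x = mderiv α f x + mderiv α g x := by
    unfold mderiv
    rw [iteratedFDeriv_add_apply (contDiffAt_of_subset hK hf hx _)
      (contDiffAt_of_subset hK hg hx _)]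
    rfl
  rw [e]
  refine (ENNReal.div_le_div_right (enorm_add_le _ _) _).trans ?_
  rw [ENNReal.add_div]
  exact add_le_add
    (le_iSup₂_of_le x hx (le_iSup_of_le α le_rfl)) (le_iSup₂_of_le x hx (le_iSup_of_le α le_rfl))

theorem unorm_smul_le (hK : K ⊆ Ω) (hf : ContDiffOn ℝ ∞ f Ω) (c : ℂ) :
    unorm M K h (c • f) ≤ ‖c‖ₑ * unorm M K h f := by
  refine iSup₂_le fun x hx => iSup_le fun α => ?_
  have e : mderiv α (c • f) x = c * mderiv α f x := by
    unfold mderiv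
    rw [iteratedFDeriv_const_smul_apply (contDiffAt_of_subset hK hf hx _)]
    rfl
  rw [e, enorm_mul, mul_div_assoc]
  gcongr
  exact le_iSup₂_of_le x hx (le_iSup_of_le α le_rfl)

theorem unorm_zero : unorm M K h (0 : RSpace d → ℂ) = 0 := by
  refine le_antisymm (iSup₂_le fun x _ => iSup_le fun α => ?_) (bot_le)
  have e : mderiv α (0 : RSpace d → ℂ) x = 0 := by
    unfold mderiv
    have : (0 : RSpace d → ℂ) = fun _ => 0 := rfl
    rw [this, iteratedFDeriv_fun_zero]
    rfl
  simp [e]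

end

/-- The space `ℰ^{(M_p)}(Ω)` of ultradifferentiable functions of Beurling type. A function on `Ω`
is represented by a function on `ℝ^d`, whose values outside `Ω` are irrelevant. -/
def Ultradiff {d : ℕ} (M : WeightSequence) (Ω : TopologicalSpace.Opens (RSpace d)) :
    Submodule ℂ (RSpace d → ℂ) where
  carrier := {f | ContDiffOn ℝ ∞ f Ω ∧
    ∀ K : Set (RSpace d), IsCompact K → K ⊆ Ω → ∀ h : ℝ, 0 < h → unorm M K h f < ⊤}
  add_mem' := by
    rintro f g ⟨hf, hf'⟩ ⟨hg, hg'⟩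
    refine ⟨hf.add hg, fun K hK hKΩ h hh => (unorm_add_le hKΩ hf hg).trans_lt ?_⟩
    exact ENNReal.add_lt_top.2 ⟨hf' K hK hKΩ h hh, hg' K hK hKΩ h hh⟩
  zero_mem' := ⟨contDiffOn_const, fun K _ _ h _ => by rw [unorm_zero]; exact ENNReal.zero_lt_top⟩
  smul_mem' := by
    rintro c f ⟨hf, hf'⟩
    refine ⟨hf.const_smul c, fun K hK hKΩ h hh => (unorm_smul_le hKΩ hf c).trans_lt ?_⟩
    exact ENNReal.mul_lt_top enorm_lt_top (hf' K hK hKΩ h hh)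

/-- The test space `𝒟^{(M_p)}(Ω)`: the elements of `ℰ^{(M_p)}(Ω)` with compact support in `Ω`,
extended by zero to `ℝ^d`. It is the union over compact `K ⊆ Ω` of the spaces `𝒟^{(M_p)}(K)`,
which consist of the `φ` in it with support in `K`. -/
def UltraTest {d : ℕ} (M : WeightSequence) (Ω : TopologicalSpace.Opens (RSpace d)) :
    Submodule ℂ (RSpace d → ℂ) where
  carrier := {φ | φ ∈ Ultradiff M Ω ∧ HasCompactSupport φ ∧ tsupport φ ⊆ Ω}
  add_mem' := by
    rintro f g ⟨hf, hf', hf''⟩ ⟨hg, hg', hg''⟩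
    exact ⟨add_mem hf hg, hf'.add hg', (tsupport_add f g).trans (Set.union_subset hf'' hg'')⟩
  zero_mem' := ⟨zero_mem _, HasCompactSupport.zero, by simp [tsupport]⟩
  smul_mem' := by
    rintro c f ⟨hf, hf', hf''⟩
    exact ⟨Submodule.smul_mem _ c hf, hf'.smul_left (f := fun _ => c),
      (tsupport_smul_subset_right (fun _ => c) f).trans hf''⟩

/-- A linear form on `𝒟^{(M_p)}(Ω)` is a Beurling ultradistribution, i.e. an element of
`𝒟'^{(M_p)}(Ω)`, if it is continuous for the inductive limit topology. This means continuity on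
each `𝒟^{(M_p)}(K)`, whose topology is given by the norms `‖·‖_{K,h}`, `h > 0`, which increase
as `h` decreases. -/
def IsUltradistribution {d : ℕ} {M : WeightSequence} {Ω : TopologicalSpace.Opens (RSpace d)}
    (T : UltraTest M Ω →ₗ[ℂ] ℂ) : Prop :=
  ∀ K : Set (RSpace d), IsCompact K → K ⊆ Ω →
    ∃ h : ℝ, 0 < h ∧ ∃ C : ℝ, 0 ≤ C ∧ ∀ φ : UltraTest M Ω, tsupport (φ : RSpace d → ℂ) ⊆ K →
      ‖T φ‖ₑ ≤ ENNReal.ofReal C * unorm M K h φ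

/-- The pairing `⟨f, φ⟩ = ∫_Ω f φ dx`. -/
def pairing {d : ℕ} {M : WeightSequence} {Ω : TopologicalSpace.Opens (RSpace d)}
    (f : RSpace d → ℂ) (φ : UltraTest M Ω) : ℂ :=
  ∫ x in (Ω : Set (RSpace d)), f x * (φ : RSpace d → ℂ) x

/-- The parameter set `(0, 1)` of the nets. -/
abbrev NetIndex : Type := Set.Ioo (0 : ℝ) 1

/-- `a_ε = O(b_ε)` as `ε → 0`, for nets `a_ε ∈ [0, ∞]` and `b_ε ∈ ℝ`, `ε ∈ (0, 1)`. -/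
def NetBigO (a : NetIndex → ℝ≥0∞) (b : NetIndex → ℝ) : Prop :=
  ∃ C : ℝ, 0 ≤ C ∧ ∃ ε₀ : NetIndex, ∀ ε : NetIndex, ε < ε₀ → a ε ≤ ENNReal.ofReal (C * b ε)

theorem NetBigO.mono {a a' : NetIndex → ℝ≥0∞} {b b' : NetIndex → ℝ} (h : NetBigO a b)
    (ha : ∀ ε, a' ε ≤ a ε) (hb : ∀ ε, b ε ≤ b' ε) : NetBigO a' b' := by
  obtain ⟨C, hC, ε₀, H⟩ := h
  exact ⟨C, hC, ε₀, fun ε hε => (ha ε).trans ((H ε hε).trans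
    (ENNReal.ofReal_le_ofReal (mul_le_mul_of_nonneg_left (hb ε) hC)))⟩

theorem NetBigO.add {a a' : NetIndex → ℝ≥0∞} {b : NetIndex → ℝ} (hb : ∀ ε, 0 ≤ b ε)
    (h : NetBigO a b) (h' : NetBigO a' b) : NetBigO (fun ε => a ε + a' ε) b := by
  obtain ⟨C, hC, ε₀, H⟩ := h
  obtain ⟨C', hC', ε₁, H'⟩ := h'
  refine ⟨C + C', add_nonneg hC hC', min ε₀ ε₁, fun ε hε => ?_⟩
  rw [add_mul, ENNReal.ofReal_add (mul_nonneg hC (hb ε)) (mul_nonneg hC' (hb ε))]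
  exact add_le_add (H ε (hε.trans_le (min_le_left _ _))) (H' ε (hε.trans_le (min_le_right _ _)))

theorem NetBigO.const_mul {a : NetIndex → ℝ≥0∞} {b : NetIndex → ℝ} (c : ℂ)
    (h : NetBigO a b) : NetBigO (fun ε => ‖c‖ₑ * a ε) b := by
  obtain ⟨C, hC, ε₀, H⟩ := h
  refine ⟨‖c‖ * C, mul_nonneg (norm_nonneg c) hC, ε₀, fun ε hε => ?_⟩
  rw [mul_assoc, ENNReal.ofReal_mul (norm_nonneg c), ofReal_norm]
  exact mul_le_mul_right (H ε hε) _

theorem NetBigO.zero {b : NetIndex → ℝ} : NetBigO (fun _ => 0) b :=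
  ⟨0, le_rfl, ⟨1 / 2, by norm_num, by norm_num⟩, fun _ _ => bot_le⟩

/-- The space `ℰ_M^{(M_p)}(Ω)` of ultramoderate nets. -/
def UltraModerate {d : ℕ} (M : WeightSequence) (Ω : TopologicalSpace.Opens (RSpace d)) :
    Submodule ℂ (NetIndex → RSpace d → ℂ) where
  carrier := {u | (∀ ε, u ε ∈ Ultradiff M Ω) ∧
    ∀ K : Set (RSpace d), IsCompact K → K ⊆ Ω → ∀ h : ℝ, 0 < h → ∃ k : ℝ, 0 ≤ k ∧
      NetBigO (fun ε => unorm M K h (u ε)) fun ε => Real.exp (M.assoc (k / ε))}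
  add_mem' := by
    rintro u v ⟨hu, hu'⟩ ⟨hv, hv'⟩
    refine ⟨fun ε => add_mem (hu ε) (hv ε), fun K hK hKΩ h hh => ?_⟩
    obtain ⟨k, hk, H⟩ := hu' K hK hKΩ h hh
    obtain ⟨k', hk', H'⟩ := hv' K hK hKΩ h hh
    have key : ∀ a b : ℝ, 0 ≤ a → a ≤ b → ∀ ε : NetIndex,
        Real.exp (M.assoc (a / ε)) ≤ Real.exp (M.assoc (b / ε)) := fun a b ha hab ε =>
      Real.exp_le_exp.2 (M.assoc_mono (div_nonneg ha ε.2.1.le)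
        (div_le_div_of_nonneg_right hab ε.2.1.le))
    refine ⟨max k k', hk.trans (le_max_left _ _), NetBigO.mono (NetBigO.add
      (fun ε => (Real.exp_pos _).le)
      (H.mono (fun _ => le_rfl) (key k _ hk (le_max_left _ _)))
      (H'.mono (fun _ => le_rfl) (key k' _ hk' (le_max_right _ _))))
      (fun ε => unorm_add_le hKΩ (hu ε).1 (hv ε).1) (fun _ => le_rfl)⟩
  zero_mem' := ⟨fun _ => zero_mem _, fun K _ _ h _ => ⟨0, le_rfl,
    NetBigO.zero.mono (fun _ => unorm_zero.le) (fun _ => le_rfl)⟩⟩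
  smul_mem' := by
    rintro c u ⟨hu, hu'⟩
    refine ⟨fun ε => Submodule.smul_mem _ c (hu ε), fun K hK hKΩ h hh => ?_⟩
    obtain ⟨k, hk, H⟩ := hu' K hK hKΩ h hh
    exact ⟨k, hk, (H.const_mul c).mono (fun ε => unorm_smul_le hKΩ (hu ε).1 c) (fun _ => le_rfl)⟩

/-- The space `𝒩^{(M_p)}(Ω)` of negligible nets. -/
def UltraNegligible {d : ℕ} (M : WeightSequence) (Ω : TopologicalSpace.Opens (RSpace d)) :
    Submodule ℂ (NetIndex → RSpace d → ℂ) where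
  carrier := {u | (∀ ε, u ε ∈ Ultradiff M Ω) ∧
    ∀ K : Set (RSpace d), IsCompact K → K ⊆ Ω → ∀ h : ℝ, 0 < h → ∀ k : ℝ, 0 ≤ k →
      NetBigO (fun ε => unorm M K h (u ε)) fun ε => Real.exp (-M.assoc (k / ε))}
  add_mem' := by
    rintro u v ⟨hu, hu'⟩ ⟨hv, hv'⟩
    refine ⟨fun ε => add_mem (hu ε) (hv ε), fun K hK hKΩ h hh k hk => ?_⟩
    exact NetBigO.mono (NetBigO.add (fun ε => (Real.exp_pos _).le)
      (hu' K hK hKΩ h hh k hk) (hv' K hK hKΩ h hh k hk))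
      (fun ε => unorm_add_le hKΩ (hu ε).1 (hv ε).1) (fun _ => le_rfl)
  zero_mem' := ⟨fun _ => zero_mem _, fun K _ _ h _ k _ =>
    NetBigO.zero.mono (fun _ => unorm_zero.le) (fun _ => le_rfl)⟩
  smul_mem' := by
    rintro c u ⟨hu, hu'⟩
    refine ⟨fun ε => Submodule.smul_mem _ c (hu ε), fun K hK hKΩ h hh k hk => ?_⟩
    exact ((hu' K hK hKΩ h hh k hk).const_mul c).mono
      (fun ε => unorm_smul_le hKΩ (hu ε).1 c) (fun _ => le_rfl)

/-- The space `𝒢^{(M_p)}(Ω) = ℰ_M^{(M_p)}(Ω) / 𝒩^{(M_p)}(Ω)` of generalized Beurling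
ultradistributions. -/
abbrev GenUltradist {d : ℕ} (M : WeightSequence) (Ω : TopologicalSpace.Opens (RSpace d)) : Type :=
  UltraModerate M Ω ⧸ (UltraNegligible M Ω).submoduleOf (UltraModerate M Ω)

/-- The class `[(u_ε)]` of an ultramoderate net. -/
def GenUltradist.mk {d : ℕ} {M : WeightSequence} {Ω : TopologicalSpace.Opens (RSpace d)}
    (u : UltraModerate M Ω) : GenUltradist M Ω :=
  Submodule.Quotient.mk u

/-- Regularity, `g ∈ 𝒢^{∞,(M_p)}(Ω)`: some representative of `g` lies in `ℰ^{∞,(M_p)}(Ω)`. -/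
def GenUltradist.IsRegular {d : ℕ} {M : WeightSequence} {Ω : TopologicalSpace.Opens (RSpace d)}
    (g : GenUltradist M Ω) : Prop :=
  ∃ u : UltraModerate M Ω, GenUltradist.mk u = g ∧
    ∀ K : Set (RSpace d), IsCompact K → K ⊆ Ω → ∃ k : ℝ, 0 < k ∧ ∀ h : ℝ, 0 < h →
      NetBigO (fun ε => unorm M K h (u.1 ε)) fun ε => Real.exp (M.assoc (k / ε))

/-- Strong `B`-association of `g = [(u_ε)]` to a linear form `T` on `𝒟^{(M_p)}(Ω)`: for every
compact `K ⊆ Ω` there is `b > 0` such that `⟨u_ε - T, φ⟩ = O(e^{-M(b/ε)})` for every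
`φ ∈ 𝒟^{(M_p)}(K)`. Negligible nets do not affect this, so one representative suffices. -/
def GenUltradist.StronglyAssociated {d : ℕ} {M : WeightSequence}
    {Ω : TopologicalSpace.Opens (RSpace d)} (g : GenUltradist M Ω)
    (T : UltraTest M Ω →ₗ[ℂ] ℂ) : Prop :=
  ∃ u : UltraModerate M Ω, GenUltradist.mk u = g ∧
    ∀ K : Set (RSpace d), IsCompact K → K ⊆ Ω → ∃ b : ℝ, 0 < b ∧
      ∀ φ : UltraTest M Ω, tsupport (φ : RSpace d → ℂ) ⊆ K →
        NetBigO (fun ε => ‖pairing (u.1 ε) φ - T φ‖ₑ) fun ε => Real.exp (-M.assoc (b / ε))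

end

/-!
Let `(v_ε)` be a regular net strongly associated to `T`, and write `E(ρ) = e^{M(ρ)}`.

*Uniformity.* Test functions with support in a compact set form a Fréchet space on which the forms
`φ ↦ E(b/ε) (⟨v_ε, φ⟩ - ⟨T, φ⟩)` are continuous and, for small `ε`, pointwise bounded. The uniform
boundedness principle turns association into
`|⟨v_ε, φ⟩ - ⟨T, φ⟩| ≤ C E(b/ε)⁻¹ ‖φ‖_h` for one fixed `h` (`exists_uniform_association`). Only
Banach–Steinhaus on `ℓ^1` is needed, applied to `a ↦ ∑ a_j φ_j` for a bounded sequence `(φ_j)`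
(`exists_bound_of_pointwise_bounded`).

*Decay.* Let `χ` be a cutoff function of Beurling class and `e_ξ(x) = e^{-2πi⟨x,ξ⟩}`. Taking
`φ = e_ξ χ`, whose norm is `O(E(κ|ξ|))`, gives
`|⟨T, e_ξ χ⟩| ≤ C E(κ|ξ|) E(b/ε)⁻¹ + |𝓕(v_ε χ)(ξ)|`. By regularity the last term is
`O(E(k/ε) E(|ξ|/h)⁻¹)` for every `h`, with `k` independent of `h`. If `ε` is a small multiple of
`1/|ξ|`, then (M.2), in the form `E(ρ)² ≤ c E(Hρ)`, shows that `τ(ξ) = ⟨T, e_ξ χ⟩` decays faster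
than every `E(λ|ξ|)⁻¹` (`rapidDecay_of_approximation`).

*Representation.* Hence `f = 𝓕(τ(-·))` is ultradifferentiable. If `χ = 1` near the support of `φ`,
then `⟨v_ε, φ⟩ = ∫ 𝓕(v_ε χ)(ξ) 𝓕φ(-ξ) dξ`; by dominated convergence
`⟨T, φ⟩ = ∫ τ(ξ) 𝓕φ(-ξ) dξ = ∫ f φ` (`exists_local_representation`). Since ultradifferentiable bump
functions separate continuous functions, the local representatives agree on overlaps and glue
(`exists_global_representation`).

The cutoff functions come from infinite convolutions of uniform densities, the widths being chosen
from the tails of `∑ M_p / M_{p+1}` (`WeightSequence.exists_widths`, `exists_cutoff`).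
-/

noncomputable section

/-! ### The weights and the associated function -/

namespace WeightSequence

variable (M : WeightSequence)

/-- The exponential `e^{M(ρ)} = sup_p ρ^p / M_p` of the associated function. -/
def expAssoc (ρ : ℝ) : ℝ := Real.exp (M.assoc ρ)

theorem expAssoc_pos (ρ : ℝ) : 0 < M.expAssoc ρ := Real.exp_pos _

theorem assoc_nonneg (ρ : ℝ) : 0 ≤ M.assoc ρ :=
  Real.iSup_nonneg fun _ => Real.posLog_nonneg

theorem one_le_expAssoc (ρ : ℝ) : 1 ≤ M.expAssoc ρ := Real.one_le_exp (M.assoc_nonneg ρ)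

theorem expAssoc_mono {ρ σ : ℝ} (hρ : 0 ≤ ρ) (h : ρ ≤ σ) : M.expAssoc ρ ≤ M.expAssoc σ :=
  Real.exp_le_exp.2 (M.assoc_mono hρ h)

theorem exp_neg_assoc (ρ : ℝ) : Real.exp (-M.assoc ρ) = (M.expAssoc ρ)⁻¹ := Real.exp_neg _

theorem pow_le_expAssoc {ρ : ℝ} (hρ : 0 ≤ ρ) (p : ℕ) : ρ ^ p ≤ M.seq p * M.expAssoc ρ := by
  rw [mul_comm, ← div_le_iff₀ (M.pos p)]
  rcases (div_nonneg (pow_nonneg hρ p) (M.pos p).le).eq_or_lt with h | h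
  · rw [← h]; exact (M.expAssoc_pos ρ).le
  · rw [expAssoc, ← Real.log_le_iff_le_exp h]
    exact (le_max_right _ _).trans (le_ciSup (M.assoc_bddAbove hρ) p)

theorem expAssoc_le {ρ B : ℝ} (hρ : 0 ≤ ρ) (h : ∀ p : ℕ, ρ ^ p ≤ B * M.seq p) :
    M.expAssoc ρ ≤ B := by
  have h1 : 1 ≤ B := by simpa [M.zero] using h 0
  have hB : 0 < B := one_pos.trans_le h1
  rw [expAssoc, ← Real.le_log_iff_exp_le hB]
  refine ciSup_le fun p => max_le (Real.log_nonneg h1) ?_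
  rcases (div_nonneg (pow_nonneg hρ p) (M.pos p).le).eq_or_lt with h0 | h0
  · rw [← h0, Real.log_zero]; exact Real.log_nonneg h1
  · exact Real.log_le_log h0 ((div_le_iff₀ (M.pos p)).2 (h p))

/-- Logarithmic convexity in the form `M_{p+1} / M_p ≤ M_{q+1} / M_q` for `p ≤ q`. -/
theorem ratio_mono {p q : ℕ} (h : p ≤ q) :
    M.seq (p + 1) / M.seq p ≤ M.seq (q + 1) / M.seq q := by
  induction q, h using Nat.le_induction with
  | base => exact le_rfl
  | succ q _ ih =>
    refine ih.trans ?_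
    rw [div_le_div_iff₀ (M.pos _) (M.pos _)]
    have := M.logConvex (q + 1) (by omega)
    rw [Nat.add_sub_cancel] at this
    nlinarith

theorem mul_le (p q : ℕ) : M.seq p * M.seq q ≤ M.seq (p + q) := by
  induction q with
  | zero => simp [M.zero]
  | succ q ih =>
    have h := M.ratio_mono (Nat.le_add_left q p)
    rw [div_le_div_iff₀ (M.pos _) (M.pos _)] at h
    have h1 : M.seq q * (M.seq p * M.seq (q + 1)) ≤ M.seq q * M.seq (p + (q + 1)) := by
      calc M.seq q * (M.seq p * M.seq (q + 1)) = (M.seq p * M.seq q) * M.seq (q + 1) := by ring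
        _ ≤ M.seq (p + q) * M.seq (q + 1) := by gcongr; exact (M.pos _).le
        _ ≤ M.seq q * M.seq (p + (q + 1)) := by rw [← add_assoc]; linarith
    exact le_of_mul_le_mul_left h1 (M.pos q)

/-- The Leibniz sums of the weights: `∑ C(n, i) M_i M_{n-i} ≤ 2^n M_n`. -/
theorem sum_choose_mul_le (n : ℕ) :
    ∑ i ∈ Finset.range (n + 1), (n.choose i : ℝ) * (M.seq i * M.seq (n - i)) ≤
      2 ^ n * M.seq n := by
  have h2 : (2 : ℝ) ^ n = ∑ i ∈ Finset.range (n + 1), (n.choose i : ℝ) := by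
    exact_mod_cast (Nat.sum_range_choose n).symm
  rw [h2, Finset.sum_mul]
  refine Finset.sum_le_sum fun i hi => ?_
  gcongr
  have := M.mul_le i (n - i)
  rwa [Nat.add_sub_cancel' (by simpa [Nat.lt_succ_iff] using hi)] at this

/-- (M.2) for a sum of indices. -/
theorem exists_seq_add_le : ∃ c H : ℝ, 1 ≤ c ∧ 1 ≤ H ∧
    ∀ p q : ℕ, M.seq (p + q) ≤ c * H ^ (p + q) * (M.seq p * M.seq q) := by
  obtain ⟨c, H, hc, hH, h⟩ := M.stable
  exact ⟨c, H, hc, hH, fun p q => by simpa using h (p + q) q (by omega)⟩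

/-- (M.2) in terms of the associated function: `2 M(ρ) ≤ M(Hρ) + ln c`. -/
theorem exists_expAssoc_sq_le : ∃ c H : ℝ, 1 ≤ c ∧ 1 ≤ H ∧
    ∀ ρ : ℝ, 0 < ρ → M.expAssoc ρ * M.expAssoc ρ ≤ c * M.expAssoc (H * ρ) := by
  obtain ⟨c, H, hc, hH, h⟩ := M.exists_seq_add_le
  refine ⟨c, H, hc, hH, fun ρ hρ => ?_⟩
  have hc0 : 0 < c := by linarith
  have hH0 : 0 < H := by linarith
  have key : ∀ p q : ℕ, ρ ^ p * ρ ^ q ≤ c * M.expAssoc (H * ρ) * (M.seq p * M.seq q) := by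
    intro p q
    have h1 := M.pow_le_expAssoc (mul_pos hH0 hρ).le (p + q)
    have h2 : H ^ (p + q) * (ρ ^ p * ρ ^ q) ≤
        H ^ (p + q) * (c * M.expAssoc (H * ρ) * (M.seq p * M.seq q)) := by
      calc H ^ (p + q) * (ρ ^ p * ρ ^ q) = (H * ρ) ^ (p + q) := by rw [mul_pow, pow_add ρ]
        _ ≤ M.seq (p + q) * M.expAssoc (H * ρ) := h1
        _ ≤ c * H ^ (p + q) * (M.seq p * M.seq q) * M.expAssoc (H * ρ) :=
          mul_le_mul_of_nonneg_right (h p q) (M.expAssoc_pos _).le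
        _ = _ := by ring
    exact le_of_mul_le_mul_left h2 (by positivity)
  have hE := M.expAssoc_pos ρ
  rw [← le_div_iff₀ hE]
  refine M.expAssoc_le hρ.le fun p => ?_
  have hp := M.pos p
  have hρp : 0 < ρ ^ p := by positivity
  rw [div_mul_eq_mul_div, le_div_iff₀ hE, mul_comm, ← le_div_iff₀ hρp]
  refine M.expAssoc_le hρ.le fun q => ?_
  rw [div_mul_eq_mul_div, le_div_iff₀ hρp]
  calc _ = ρ ^ p * ρ ^ q := mul_comm _ _
    _ ≤ _ := key p q
    _ = _ := by ring

theorem div_le_expAssoc {ρ : ℝ} (hρ : 0 ≤ ρ) : ρ / M.seq 1 ≤ M.expAssoc ρ := by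
  rw [div_le_iff₀ (M.pos 1)]
  simpa [mul_comm] using M.pow_le_expAssoc hρ 1

end WeightSequence

/-! ### Full derivatives versus partial derivatives -/

section Symmetry

variable {E F : Type*} [NormedAddCommGroup E] [NormedSpace ℝ E] [NormedAddCommGroup F]
  [NormedSpace ℝ F] {f : E → F} {s : Set E}

theorem differentiableAt_iteratedFDeriv_of_contDiffOn (hs : IsOpen s) (hf : ContDiffOn ℝ ∞ f s)
    {x : E} (hx : x ∈ s) (n : ℕ) : DifferentiableAt ℝ (iteratedFDeriv ℝ n f) x :=
  (hf.contDiffAt (hs.mem_nhds hx)).differentiableAt_iteratedFDeriv (by exact_mod_cast ENat.natCast_lt_top n)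

theorem fderiv_iteratedFDeriv_apply (hs : IsOpen s) (hf : ContDiffOn ℝ ∞ f s) {x : E} (hx : x ∈ s)
    {n : ℕ} (v : Fin n → E) (w : E) :
    fderiv ℝ (fun y => iteratedFDeriv ℝ n f y v) x w = (fderiv ℝ (iteratedFDeriv ℝ n f) x w) v :=
  fderiv_continuousMultilinear_apply_const_apply
    (differentiableAt_iteratedFDeriv_of_contDiffOn hs hf hx n) v w

/-- Invariance of `D^{n+1} f` under transpositions of adjacent directions, by induction on `n`. -/
theorem iteratedFDeriv_comp_swap (hs : IsOpen s) (hf : ContDiffOn ℝ ∞ f s) :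
    ∀ (n : ℕ) (i : Fin n) (v : Fin (n + 1) → E) (x : E), x ∈ s →
      iteratedFDeriv ℝ (n + 1) f x (v ∘ Equiv.swap i.castSucc i.succ) =
        iteratedFDeriv ℝ (n + 1) f x v := by
  intro n
  induction n with
  | zero => exact fun i => i.elim0
  | succ n ih =>
    intro i v x hx
    induction i using Fin.cases with
    | zero =>
      -- the two outermost directions: symmetry of the second derivative of `D^n f`
      have h2 : (2 : WithTop ℕ∞) + (n : WithTop ℕ∞) ≤ ((⊤ : ℕ∞) : WithTop ℕ∞) := by
        have hk : ∀ k : ℕ, (k : WithTop ℕ∞) ≤ ((⊤ : ℕ∞) : WithTop ℕ∞) :=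
          fun k => by exact_mod_cast le_top
        simpa using hk (2 + n)
      have key : ∀ u : Fin (n + 2) → E, iteratedFDeriv ℝ (n + 1 + 1) f x u =
          (fderiv ℝ (fderiv ℝ (iteratedFDeriv ℝ n f)) x (u 0) (u 1)) (fun j => u j.succ.succ) := by
        intro u
        have hd : ContDiffAt ℝ 1 (fderiv ℝ (iteratedFDeriv ℝ n f)) x :=
          ((hf.contDiffAt (hs.mem_nhds hx)).iteratedFDeriv_right (m := 2) (i := n)
            h2).fderiv_right (by norm_num)
        have hd' : DifferentiableAt ℝ (fderiv ℝ (iteratedFDeriv ℝ n f)) x :=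
          hd.differentiableAt (by norm_num)
        rw [iteratedFDeriv_succ_apply_left, ← fderiv_iteratedFDeriv_apply hs hf hx]
        simp only [iteratedFDeriv_succ_apply_left]
        have e : (fun y => (fderiv ℝ (iteratedFDeriv ℝ n f) y (Fin.tail u 0))
            (Fin.tail (Fin.tail u))) = fun y => (fun z => fderiv ℝ (iteratedFDeriv ℝ n f) z (u 1)) y
              (fun j => u j.succ.succ) := rfl
        rw [e, fderiv_continuousMultilinear_apply_const_apply
          (hd'.clm_apply (differentiableAt_const _)), fderiv_clm_apply hd' (differentiableAt_const _)]
        simp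
      have hsym : IsSymmSndFDerivAt ℝ (iteratedFDeriv ℝ n f) x := by
        refine ((hf.contDiffAt (hs.mem_nhds hx)).iteratedFDeriv_right (m := 2) (i := n)
            h2).isSymmSndFDerivAt (by simp)
      rw [key, key, hsym.eq]
      have h0 : (v ∘ Equiv.swap (Fin.castSucc (0 : Fin (n + 1))) (Fin.succ 0)) 0 = v 1 := by simp
      have h1 : (v ∘ Equiv.swap (Fin.castSucc (0 : Fin (n + 1))) (Fin.succ 0)) 1 = v 0 := by simp
      rw [h0, h1]
      congr 1
    | succ i =>
      have key : ∀ u : Fin (n + 2) → E, iteratedFDeriv ℝ (n + 1 + 1) f x u =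
          fderiv ℝ (fun y => iteratedFDeriv ℝ (n + 1) f y (Fin.tail u)) x (u 0) := by
        intro u
        rw [iteratedFDeriv_succ_apply_left, fderiv_iteratedFDeriv_apply hs hf hx]
      have hz : (v ∘ Equiv.swap i.succ.castSucc i.succ.succ) 0 = v 0 := by
        rw [Function.comp_apply, Equiv.swap_apply_of_ne_of_ne]
        · exact (Fin.ne_of_lt (Fin.castSucc_pos (Fin.succ_pos i)))
        · exact (Fin.succ_ne_zero _).symm
      have ht : Fin.tail (v ∘ Equiv.swap i.succ.castSucc i.succ.succ) =
          Fin.tail v ∘ Equiv.swap i.castSucc i.succ := by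
        funext j
        simp only [Fin.tail, Function.comp_apply]
        congr 1
        have : i.succ.castSucc = i.castSucc.succ := rfl
        rw [this, ← (Fin.succ_injective _).map_swap]
      rw [key, key, hz, ht]
      congr 1
      refine Filter.EventuallyEq.fderiv_eq ?_
      filter_upwards [hs.mem_nhds hx] with y hy
      exact ih i _ y hy

/-- The derivatives of a smooth function on an open set are symmetric. -/
theorem iteratedFDeriv_comp_perm_of_contDiffOn (hs : IsOpen s) (hf : ContDiffOn ℝ ∞ f s) {x : E}
    (hx : x ∈ s) {n : ℕ} (σ : Equiv.Perm (Fin n)) (v : Fin n → E) :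
    iteratedFDeriv ℝ n f x (v ∘ σ) = iteratedFDeriv ℝ n f x v := by
  cases n with
  | zero => congr 1; exact Subsingleton.elim _ _
  | succ n =>
    have hσ : σ ∈ Submonoid.closure
        (Set.range fun i : Fin n => Equiv.swap i.castSucc i.succ) := by
      rw [Equiv.Perm.mclosure_swap_castSucc_succ]; trivial
    induction hσ using Submonoid.closure_induction generalizing v with
    | mem y hy =>
      obtain ⟨i, rfl⟩ := hy
      exact iteratedFDeriv_comp_swap hs hf n i v x hx
    | one => rfl
    | mul a b _ _ iha ihb =>
      rw [Equiv.Perm.coe_mul, ← Function.comp_assoc, ihb, iha]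

end Symmetry

section Gauge

variable {d : ℕ} {M : WeightSequence} {Ω : TopologicalSpace.Opens (RSpace d)}
  {K : Set (RSpace d)} {h : ℝ} {f g : RSpace d → ℂ}

theorem norm_mderiv_le (α : Fin d → ℕ) (f : RSpace d → ℂ) (x : RSpace d) :
    ‖mderiv α f x‖ ≤ ‖iteratedFDeriv ℝ (∑ j, α j) f x‖ := by
  unfold mderiv
  refine (ContinuousMultilinearMap.le_opNorm _ _).trans ?_
  simp

/-- Every derivative in coordinate directions is one of the `∂^α f`. -/
theorem exists_mderiv_eq (hf : ContDiffOn ℝ ∞ f Ω) {x : RSpace d} (hx : x ∈ Ω) {n : ℕ}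
    (r : Fin n → Fin d) : ∃ α : Fin d → ℕ, ∑ j, α j = n ∧
      iteratedFDeriv ℝ n f x (fun i => EuclideanSpace.single (r i) (1 : ℝ)) = mderiv α f x := by
  classical
  set α : Fin d → ℕ := fun j => Fintype.card {i // r i = j} with hα
  let e : Fin n ≃ Fin (∑ j, α j) :=
    ((Equiv.sigmaFiberEquiv r).symm.trans
      (Equiv.sigmaCongrRight fun j => Fintype.equivFin {i // r i = j})).trans finSigmaFinEquiv
  have hr : ∀ i, (finSigmaFinEquiv.symm (e i)).1 = r i := by
    intro i
    simp only [e, Equiv.trans_apply, Equiv.symm_apply_apply]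
    rfl
  have hn : ∑ j, α j = n := by simpa using (Fintype.card_congr e).symm
  refine ⟨α, hn, ?_⟩
  unfold mderiv
  clear_value e
  generalize hg : (fun i : Fin (∑ j, α j) =>
    (EuclideanSpace.single (finSigmaFinEquiv.symm i).1 (1 : ℝ) : RSpace d)) = v
  have hv : (fun i => (EuclideanSpace.single (r i) (1 : ℝ) : RSpace d)) = v ∘ e := by
    funext i
    rw [← hg, Function.comp_apply, hr]
  rw [hv]
  clear hv hg hr
  generalize ∑ j, α j = m at *
  subst hn
  exact iteratedFDeriv_comp_perm_of_contDiffOn Ω.isOpen hf hx e v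

theorem norm_iteratedFDeriv_le_of_mderiv (hf : ContDiffOn ℝ ∞ f Ω) {x : RSpace d} (hx : x ∈ Ω)
    {n : ℕ} {C : ℝ} (hC : 0 ≤ C) (h : ∀ α : Fin d → ℕ, ∑ j, α j = n → ‖mderiv α f x‖ ≤ C) :
    ‖iteratedFDeriv ℝ n f x‖ ≤ d ^ n * C := by
  classical
  refine ContinuousMultilinearMap.opNorm_le_bound (by positivity) fun v => ?_
  have hv : v = fun i => ∑ j, (v i j) • (EuclideanSpace.single j (1 : ℝ) : RSpace d) := by
    funext i
    ext k
    simp [Finset.sum_apply, Pi.single_apply]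
  conv_lhs => rw [hv]
  have := (iteratedFDeriv ℝ n f x).toMultilinearMap.map_sum
    (fun (i : Fin n) (j : Fin d) => (v i j) • (EuclideanSpace.single j (1 : ℝ) : RSpace d))
  simp only [ContinuousMultilinearMap.coe_coe] at this
  rw [this]
  refine (norm_sum_le_of_le (f := _) _ (fun r _ => ?_)
    (n := fun _ => C * ∏ i, ‖v i‖)).trans ?_
  · rw [ContinuousMultilinearMap.map_smul_univ, norm_smul, mul_comm]
    obtain ⟨α, hα, e⟩ := exists_mderiv_eq hf hx r
    rw [e, norm_prod]
    refine mul_le_mul (h α hα) (Finset.prod_le_prod (fun _ _ => norm_nonneg _) fun i _ => ?_)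
      (Finset.prod_nonneg fun _ _ => norm_nonneg _) hC
    exact PiLp.norm_apply_le (v i) (r i)
  · simp [mul_assoc]

theorem WeightSequence.gauge_pos (M : WeightSequence) (hh : 0 < h) (n : ℕ) :
    0 < h ^ n * M.seq n := mul_pos (pow_pos hh n) (M.pos n)

/-- Finiteness of `unorm` as bounds for the full derivatives. The factor `(d + 1)^n` is harmless
since every `h > 0` is allowed in the Beurling case. -/
theorem norm_iteratedFDeriv_le_of_unorm_le (hK : K ⊆ Ω) (hf : ContDiffOn ℝ ∞ f Ω) (hh : 0 < h)
    {C : ℝ} (hC : 0 ≤ C) (hu : unorm M K h f ≤ ENNReal.ofReal C) {x : RSpace d} (hx : x ∈ K)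
    (n : ℕ) : ‖iteratedFDeriv ℝ n f x‖ ≤ C * (((d + 1) * h) ^ n * M.seq n) := by
  have key : ∀ α : Fin d → ℕ, ∑ j, α j = n → ‖mderiv α f x‖ ≤ C * (h ^ n * M.seq n) := by
    rintro α rfl
    have h1 : ‖mderiv α f x‖ₑ / ENNReal.ofReal (h ^ (∑ j, α j) * M.seq (∑ j, α j)) ≤
        ENNReal.ofReal C :=
      (le_iSup₂_of_le (f := fun x _ => ⨆ α : Fin d → ℕ, ‖mderiv α f x‖ₑ /
        ENNReal.ofReal (h ^ (∑ j, α j) * M.seq (∑ j, α j))) x hx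
        (le_iSup (fun α : Fin d → ℕ => ‖mderiv α f x‖ₑ /
        ENNReal.ofReal (h ^ (∑ j, α j) * M.seq (∑ j, α j))) α)).trans hu
    have hp := M.gauge_pos hh (∑ j, α j)
    rw [ENNReal.div_le_iff (by simpa using hp) ENNReal.ofReal_ne_top,
      ← ENNReal.ofReal_mul hC, ← ofReal_norm, ENNReal.ofReal_le_ofReal_iff (by positivity)] at h1
    exact h1
  have hp := M.gauge_pos hh n
  refine (norm_iteratedFDeriv_le_of_mderiv hf (hK hx) (by positivity) key).trans ?_
  rw [mul_pow]
  have h3 : (d : ℝ) ^ n ≤ (d + 1 : ℝ) ^ n := by gcongr; linarith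
  calc (d : ℝ) ^ n * (C * (h ^ n * M.seq n)) ≤ (d + 1 : ℝ) ^ n * (C * (h ^ n * M.seq n)) := by
        gcongr
    _ = _ := by ring

theorem unorm_le_of_norm_iteratedFDeriv_le (hh : 0 < h) {C : ℝ} (hC : 0 ≤ C)
    (hf : ∀ x ∈ K, ∀ n : ℕ, ‖iteratedFDeriv ℝ n f x‖ ≤ C * (h ^ n * M.seq n)) :
    unorm M K h f ≤ ENNReal.ofReal C := by
  refine iSup₂_le fun x hx => iSup_le fun α => ?_
  have hp := M.gauge_pos hh (∑ j, α j)
  rw [ENNReal.div_le_iff (by simpa using hp) ENNReal.ofReal_ne_top, ← ENNReal.ofReal_mul hC,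
    ← ofReal_norm, ENNReal.ofReal_le_ofReal_iff (by positivity)]
  exact (norm_mderiv_le α f x).trans (hf x hx _)

end Gauge

/-! ### Algebra of ultradifferentiable functions; characters -/

section Algebra

variable {d : ℕ} {M : WeightSequence} {Ω : TopologicalSpace.Opens (RSpace d)}
  {K : Set (RSpace d)} {h : ℝ} {f g : RSpace d → ℂ}

/-- Membership in `ℰ^{(M_p)}(Ω)` in terms of the full derivatives. -/
theorem mem_ultradiff_iff : f ∈ Ultradiff M Ω ↔ ContDiffOn ℝ ∞ f Ω ∧
    ∀ K : Set (RSpace d), IsCompact K → K ⊆ Ω → ∀ h : ℝ, 0 < h → ∃ C : ℝ, 0 ≤ C ∧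
      ∀ x ∈ K, ∀ n : ℕ, ‖iteratedFDeriv ℝ n f x‖ ≤ C * (h ^ n * M.seq n) := by
  refine ⟨fun hf => ⟨hf.1, fun K hK hKΩ h hh => ?_⟩, fun hf => ⟨hf.1, fun K hK hKΩ h hh => ?_⟩⟩
  · have hd : (0 : ℝ) < d + 1 := by positivity
    refine ⟨(unorm M K (h / (d + 1)) f).toReal, ENNReal.toReal_nonneg, fun x hx n => ?_⟩
    have := norm_iteratedFDeriv_le_of_unorm_le hKΩ hf.1 (div_pos hh hd) ENNReal.toReal_nonneg
      (ENNReal.ofReal_toReal (hf.2 K hK hKΩ _ (div_pos hh hd)).ne).ge hx n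
    rwa [mul_div_cancel₀ _ hd.ne'] at this
  · obtain ⟨C, hC, H⟩ := hf.2 K hK hKΩ h hh
    exact (unorm_le_of_norm_iteratedFDeriv_le hh hC H).trans_lt ENNReal.ofReal_lt_top

/-- Leibniz' rule for gauge bounds: the constants multiply and `h` doubles. -/
theorem norm_iteratedFDeriv_mul_le_gauge (hf : ContDiffOn ℝ ∞ f Ω) (hg : ContDiffOn ℝ ∞ g Ω)
    {x : RSpace d} (hx : x ∈ Ω) (hh : 0 < h) {A B : ℝ} (hA : 0 ≤ A)
    (hfA : ∀ n : ℕ, ‖iteratedFDeriv ℝ n f x‖ ≤ A * (h ^ n * M.seq n))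
    (hgB : ∀ n : ℕ, ‖iteratedFDeriv ℝ n g x‖ ≤ B * (h ^ n * M.seq n)) (n : ℕ) :
    ‖iteratedFDeriv ℝ n (f * g) x‖ ≤ A * B * ((2 * h) ^ n * M.seq n) := by
  have hB : 0 ≤ B := by simpa [M.zero] using (norm_nonneg _).trans (hgB 0)
  have h1 := norm_iteratedFDerivWithin_mul_le hf hg Ω.isOpen.uniqueDiffOn hx (n := n)
    (by exact_mod_cast le_top)
  simp only [iteratedFDerivWithin_of_isOpen _ Ω.isOpen hx] at h1
  refine h1.trans ?_
  calc _ ≤ ∑ i ∈ Finset.range (n + 1),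
        (A * B * h ^ n) * ((n.choose i : ℝ) * (M.seq i * M.seq (n - i))) := by
        refine Finset.sum_le_sum fun i hi => ?_
        have hi' : i + (n - i) = n := Nat.add_sub_cancel' (by simpa [Nat.lt_succ_iff] using hi)
        have hp := M.gauge_pos hh i
        calc (n.choose i : ℝ) * ‖iteratedFDeriv ℝ i f x‖ * ‖iteratedFDeriv ℝ (n - i) g x‖
            ≤ (n.choose i : ℝ) * (A * (h ^ i * M.seq i)) * (B * (h ^ (n - i) * M.seq (n - i))) := by
              gcongr
              · exact hfA i
              · exact hgB _
          _ = A * B * h ^ (i + (n - i)) * ((n.choose i : ℝ) * (M.seq i * M.seq (n - i))) := by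
              rw [pow_add]; ring
          _ = _ := by rw [hi']
    _ ≤ (A * B * h ^ n) * (2 ^ n * M.seq n) := by
        rw [← Finset.mul_sum]
        gcongr
        exact M.sum_choose_mul_le n
    _ = _ := by rw [mul_pow]; ring

theorem mul_mem_ultradiff (hf : f ∈ Ultradiff M Ω) (hg : g ∈ Ultradiff M Ω) :
    f * g ∈ Ultradiff M Ω := by
  rw [mem_ultradiff_iff] at hf hg ⊢
  refine ⟨hf.1.mul hg.1, fun K hK hKΩ h hh => ?_⟩
  obtain ⟨A, hA, hfA⟩ := hf.2 K hK hKΩ (h / 2) (by positivity)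
  obtain ⟨B, hB, hgB⟩ := hg.2 K hK hKΩ (h / 2) (by positivity)
  refine ⟨A * B, by positivity, fun x hx n => ?_⟩
  have := norm_iteratedFDeriv_mul_le_gauge hf.1 hg.1 (hKΩ hx) (by positivity) hA (hfA x hx)
    (hgB x hx) n
  rwa [mul_div_cancel₀ _ two_ne_zero] at this

theorem mul_mem_ultraTest {φ : RSpace d → ℂ} (hf : f ∈ Ultradiff M Ω) (hφ : φ ∈ UltraTest M Ω) :
    f * φ ∈ UltraTest M Ω :=
  ⟨mul_mem_ultradiff hf hφ.1, hφ.2.1.mul_left, tsupport_mul_subset_right.trans hφ.2.2⟩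

theorem contDiff_of_mem_ultraTest {φ : RSpace d → ℂ} (hφ : φ ∈ UltraTest M Ω) :
    ContDiff ℝ ∞ φ := by
  rw [contDiff_iff_contDiffAt]
  intro x
  by_cases hx : x ∈ tsupport φ
  · exact hφ.1.1.contDiffAt (Ω.isOpen.mem_nhds (hφ.2.2 hx))
  · exact contDiffAt_const.congr_of_eventuallyEq (notMem_tsupport_iff_eventuallyEq.1 hx)

theorem iteratedFDeriv_eq_zero_of_notMem_tsupport {φ : RSpace d → ℂ} {x : RSpace d}
    (hx : x ∉ tsupport φ) (n : ℕ) : iteratedFDeriv ℝ n φ x = 0 := by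
  by_contra h
  exact hx (support_iteratedFDeriv_subset n h)

/-- The bound `‖D^n φ‖ ≤ B h^n M_n` on all of `ℝ^d`. -/
def GaugeLE (M : WeightSequence) (h B : ℝ) (φ : RSpace d → ℂ) : Prop :=
  ∀ x : RSpace d, ∀ n : ℕ, ‖iteratedFDeriv ℝ n φ x‖ ≤ B * (h ^ n * M.seq n)

/-- Gauge bounds on the support of a function hold everywhere. -/
theorem gaugeLE_of_tsupport_subset {φ : RSpace d → ℂ} (hK : tsupport φ ⊆ K) (hh : 0 < h)
    {C : ℝ} (hC : 0 ≤ C)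
    (H : ∀ x ∈ K, ∀ n : ℕ, ‖iteratedFDeriv ℝ n φ x‖ ≤ C * (h ^ n * M.seq n)) :
    GaugeLE M h C φ := by
  intro x n
  by_cases hx : x ∈ K
  · exact H x hx n
  · rw [iteratedFDeriv_eq_zero_of_notMem_tsupport (fun h' => hx (hK h')), norm_zero]
    exact mul_nonneg hC (M.gauge_pos hh n).le

theorem exists_gaugeLE {φ : RSpace d → ℂ} (hφ : φ ∈ UltraTest M Ω) (hh : 0 < h) :
    ∃ C : ℝ, 0 ≤ C ∧ GaugeLE M h C φ := by
  obtain ⟨C, hC, H⟩ := (mem_ultradiff_iff.1 hφ.1).2 _ hφ.2.1 hφ.2.2 h hh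
  exact ⟨C, hC, gaugeLE_of_tsupport_subset le_rfl hh hC H⟩

/-- Only the behaviour near compact subsets matters for membership in `ℰ^{(M_p)}(Ω)`. -/
theorem mem_ultradiff_of_locally (h : ∀ K : Set (RSpace d), IsCompact K → K ⊆ Ω →
    ∃ f ∈ Ultradiff M Ω, ∃ U : Set (RSpace d), IsOpen U ∧ K ⊆ U ∧ Set.EqOn g f U) :
    g ∈ Ultradiff M Ω := by
  rw [mem_ultradiff_iff]
  have hev : ∀ {f : RSpace d → ℂ} {U : Set (RSpace d)}, IsOpen U → Set.EqOn g f U →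
      ∀ x ∈ U, g =ᶠ[𝓝 x] f := fun hU hfg x hx => hfg.eventuallyEq_of_mem (hU.mem_nhds hx)
  refine ⟨fun x hx => ?_, fun K hK hKΩ η hη => ?_⟩
  · obtain ⟨f, hf, U, hU, hxU, hfg⟩ := h {x} isCompact_singleton (by simpa using hx)
    exact ((hf.1.contDiffAt (Ω.isOpen.mem_nhds hx)).congr_of_eventuallyEq
      (hev hU hfg x (hxU rfl))).contDiffWithinAt
  · obtain ⟨f, hf, U, hU, hKU, hfg⟩ := h K hK hKΩ
    obtain ⟨C, hC, H⟩ := (mem_ultradiff_iff.1 hf).2 K hK hKΩ η hη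
    refine ⟨C, hC, fun x hx n => ?_⟩
    rw [((hev hU hfg x (hKU hx)).iteratedFDeriv ℝ n).self_of_nhds]
    exact H x hx n

/-- A function on `ℝ` with Beurling bounds, composed with a linear form. -/
theorem comp_mem_ultradiff {φ : ℝ → ℂ} (hφ : ContDiff ℝ ∞ φ)
    (H : ∀ h : ℝ, 0 < h → ∃ C : ℝ, 0 ≤ C ∧ ∀ x : ℝ, ∀ n : ℕ,
      ‖iteratedFDeriv ℝ n φ x‖ ≤ C * (h ^ n * M.seq n)) (ℓ : RSpace d →L[ℝ] ℝ) :
    φ ∘ ℓ ∈ Ultradiff M Ω := by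
  rw [mem_ultradiff_iff]
  refine ⟨(hφ.comp ℓ.contDiff).contDiffOn, fun K hK hKΩ h hh => ?_⟩
  have hℓ : 0 < ‖ℓ‖ + 1 := by positivity
  obtain ⟨C, hC, HC⟩ := H (h / (‖ℓ‖ + 1)) (by positivity)
  refine ⟨C, hC, fun x _ n => ?_⟩
  rw [ℓ.iteratedFDeriv_comp_right hφ x (by exact_mod_cast le_top)]
  refine (ContinuousMultilinearMap.norm_compContinuousLinearMap_le _ _).trans ?_
  rw [Finset.prod_const, Finset.card_univ, Fintype.card_fin]
  have hp := M.gauge_pos (div_pos hh hℓ) n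
  calc _ ≤ C * ((h / (‖ℓ‖ + 1)) ^ n * M.seq n) * (‖ℓ‖ + 1) ^ n := by
        gcongr
        · exact HC _ n
        · linarith
    _ = C * ((h / (‖ℓ‖ + 1) * (‖ℓ‖ + 1)) ^ n * M.seq n) := by rw [mul_pow]; ring
    _ = _ := by rw [div_mul_cancel₀ _ hℓ.ne']

theorem const_mem_ultradiff (c : ℂ) : (fun _ => c) ∈ Ultradiff M Ω := by
  rw [mem_ultradiff_iff]
  refine ⟨contDiffOn_const, fun K _ _ h hh => ⟨‖c‖, norm_nonneg _, fun x _ n => ?_⟩⟩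
  rcases n with _ | n
  · simp [M.zero]
  · rw [iteratedFDeriv_const_of_ne (by omega)]
    simpa using mul_nonneg (norm_nonneg c) (M.gauge_pos hh (n + 1)).le

end Algebra

section Wave

variable {d : ℕ} {M : WeightSequence} {Ω : TopologicalSpace.Opens (RSpace d)}

/-- The character `x ↦ e^{-2πi⟨x, ξ⟩}` of the Fourier transform. -/
def wave (ξ x : RSpace d) : ℂ := (Real.fourierChar (-inner ℝ x ξ) : ℂ)

theorem contDiff_fourierChar : ContDiff ℝ ∞ (fun t : ℝ => (Real.fourierChar t : ℂ)) := by
  simp only [Real.fourierChar_apply]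
  exact Complex.contDiff_exp.comp
    ((Complex.ofRealCLM.contDiff.comp (contDiff_const.mul contDiff_id)).mul contDiff_const)

theorem norm_iteratedFDeriv_fourierChar (n : ℕ) (t : ℝ) :
    ‖iteratedFDeriv ℝ n (fun t : ℝ => (Real.fourierChar t : ℂ)) t‖ = (2 * Real.pi) ^ n := by
  have h : ∀ n : ℕ, iteratedDeriv n (fun t : ℝ => (Real.fourierChar t : ℂ)) =
      fun t => (2 * Real.pi * Complex.I) ^ n * (Real.fourierChar t : ℂ) := by
    intro n
    induction n with
    | zero => simp
    | succ n ih =>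
      rw [iteratedDeriv_succ, ih]
      funext t
      rw [deriv_const_mul _ (Real.differentiable_fourierChar t), Real.deriv_fourierChar]
      ring
  rw [norm_iteratedFDeriv_eq_norm_iteratedDeriv, h]
  simp [abs_of_pos Real.pi_pos, Circle.norm_coe]

theorem wave_eq_comp (ξ : RSpace d) :
    wave ξ = (fun t : ℝ => (Real.fourierChar t : ℂ)) ∘ (-(innerSL ℝ ξ)) := by
  funext x
  simp [wave, real_inner_comm]

theorem contDiff_wave (ξ : RSpace d) : ContDiff ℝ ∞ (wave ξ) := by
  rw [wave_eq_comp]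
  exact contDiff_fourierChar.comp (ContinuousLinearMap.contDiff _)

theorem norm_iteratedFDeriv_wave_le (ξ x : RSpace d) (n : ℕ) :
    ‖iteratedFDeriv ℝ n (wave ξ) x‖ ≤ (2 * Real.pi * ‖ξ‖) ^ n := by
  rw [wave_eq_comp, ContinuousLinearMap.iteratedFDeriv_comp_right _ contDiff_fourierChar x
    (by exact_mod_cast le_top)]
  refine (ContinuousMultilinearMap.norm_compContinuousLinearMap_le _ _).trans ?_
  rw [norm_iteratedFDeriv_fourierChar]
  simp [mul_pow]

/-- The growth of characters: `‖e_ξ‖_h ≤ e^{M(2π|ξ|/h)}`. -/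
theorem norm_iteratedFDeriv_wave_le_gauge {h : ℝ} (hh : 0 < h) (ξ x : RSpace d) (n : ℕ) :
    ‖iteratedFDeriv ℝ n (wave ξ) x‖ ≤
      M.expAssoc (2 * Real.pi * ‖ξ‖ / h) * (h ^ n * M.seq n) := by
  refine (norm_iteratedFDeriv_wave_le ξ x n).trans ?_
  have := M.pow_le_expAssoc (ρ := 2 * Real.pi * ‖ξ‖ / h) (by positivity) n
  rw [div_pow, div_le_iff₀ (by positivity)] at this
  linarith

theorem wave_mem_ultradiff (ξ : RSpace d) : wave ξ ∈ Ultradiff M Ω := by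
  rw [mem_ultradiff_iff]
  exact ⟨(contDiff_wave ξ).contDiffOn, fun K _ _ h hh => ⟨_, (M.expAssoc_pos _).le,
    fun x _ n => norm_iteratedFDeriv_wave_le_gauge hh ξ x n⟩⟩

end Wave

/-! ### Infinite convolutions on the line -/

section IteratedAverages

/-- The average of `f` over `[x - a, x]`, i.e. the convolution of `f` with the uniform density on
`[0, a]`. -/
def slidingAverage (a : ℝ) (f : ℝ → ℝ) (x : ℝ) : ℝ := ∫ t in (0 : ℝ)..1, f (x - a * t)

theorem hasDerivAt_slidingAverage {a : ℝ} (ha : a ≠ 0) {f : ℝ → ℝ} (hf : Continuous f) (x : ℝ) :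
    HasDerivAt (slidingAverage a f) ((f x - f (x - a)) / a) x := by
  have hi : ∀ u v : ℝ, IntervalIntegrable f volume u v := fun u v => hf.intervalIntegrable u v
  have e : slidingAverage a f = fun x => a⁻¹ * ((∫ t in (0 : ℝ)..x, f t) - ∫ t in (0 : ℝ)..(x - a), f t) := by
    funext y
    rw [slidingAverage, intervalIntegral.integral_comp_sub_mul f ha,
      intervalIntegral.integral_interval_sub_left (hi _ _) (hi _ _)]
    simp
  have hF : ∀ y, HasDerivAt (fun x => ∫ t in (0 : ℝ)..x, f t) (f y) y := fun y =>
    hf.integral_hasStrictDerivAt 0 y |>.hasDerivAt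
  rw [e, div_eq_inv_mul]
  exact ((hF x).sub ((hF (x - a)).comp_sub_const x a)).const_mul a⁻¹

theorem abs_slidingAverage_sub_le {a : ℝ} {f g : ℝ → ℝ} (hf : Continuous f) (hg : Continuous g) {C x y : ℝ}
    (h : ∀ t ∈ Set.Icc (0 : ℝ) 1, |f (x - a * t) - g (y - a * t)| ≤ C) :
    |slidingAverage a f x - slidingAverage a g y| ≤ C := by
  rw [slidingAverage, slidingAverage, ← intervalIntegral.integral_sub
    (Continuous.intervalIntegrable (by fun_prop) _ _)
    (Continuous.intervalIntegrable (by fun_prop) _ _)]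
  have := intervalIntegral.norm_integral_le_of_norm_le_const (a := (0 : ℝ)) (b := 1)
    (f := fun t => f (x - a * t) - g (y - a * t)) (C := C) (fun t ht => by
      rw [Set.uIoc_of_le zero_le_one] at ht
      exact h t ⟨ht.1.le, ht.2⟩)
  simpa using this

theorem slidingAverage_eq_of_eqOn {a : ℝ} {f : ℝ → ℝ} {c x : ℝ}
    (h : ∀ t ∈ Set.Icc (0 : ℝ) 1, f (x - a * t) = c) : slidingAverage a f x = c := by
  rw [slidingAverage, intervalIntegral.integral_congr (g := fun _ => c)]
  · simp
  · intro t ht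
    rw [Set.uIcc_of_le zero_le_one] at ht
    exact h t ht

/-- The `n`-fold average of `θ` with the widths `a p, …, a (p + n - 1)`. -/
def iterAverage (a : ℕ → ℝ) (θ : ℝ → ℝ) : ℕ → ℕ → ℝ → ℝ
  | 0, _ => θ
  | n + 1, p => slidingAverage (a p) (iterAverage a θ n (p + 1))

variable {a : ℕ → ℝ} {θ : ℝ → ℝ} {L : ℝ}

theorem iterAverage_lipschitz (hθ : ∀ x y, |θ x - θ y| ≤ L * |x - y|) (n : ℕ) :
    ∀ p x y, |iterAverage a θ n p x - iterAverage a θ n p y| ≤ L * |x - y| := by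
  induction n with
  | zero => exact fun _ => hθ
  | succ n ih =>
    intro p x y
    have hc : Continuous (iterAverage a θ n (p + 1)) :=
      (LipschitzWith.of_dist_le' (K := L) (ih (p + 1))).continuous
    refine abs_slidingAverage_sub_le hc hc fun t _ => ?_
    simpa using ih (p + 1) (x - a p * t) (y - a p * t)

theorem continuous_iterAverage (hθ : ∀ x y, |θ x - θ y| ≤ L * |x - y|) (n p : ℕ) :
    Continuous (iterAverage a θ n p) :=
  (LipschitzWith.of_dist_le' (K := L) (iterAverage_lipschitz hθ n p)).continuous

theorem abs_iterAverage_succ_sub_le (ha : ∀ j, 0 ≤ a j) (hL : 0 ≤ L)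
    (hθ : ∀ x y, |θ x - θ y| ≤ L * |x - y|) (n : ℕ) :
    ∀ p x, |iterAverage a θ (n + 1) p x - iterAverage a θ n p x| ≤ L * a (p + n) := by
  induction n with
  | zero =>
    intro p x
    have hc : Continuous θ := continuous_iterAverage (a := a) hθ 0 0
    have e : slidingAverage 0 θ x = θ x := by simp [slidingAverage]
    have e' : iterAverage a θ 0 p x = slidingAverage 0 θ x := by rw [e]; rfl
    rw [e']
    have : slidingAverage 0 θ x = slidingAverage (a p) (fun _ => θ x) x := by simp [slidingAverage]
    rw [this]
    refine abs_slidingAverage_sub_le hc continuous_const fun t ht => (hθ _ _).trans ?_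
    simp only [sub_sub_cancel_left, abs_neg, abs_mul, abs_of_nonneg (ha p), abs_of_nonneg ht.1]
    gcongr
    exact mul_le_of_le_one_right (ha p) ht.2
  | succ n ih =>
    intro p x
    refine abs_slidingAverage_sub_le (continuous_iterAverage hθ _ _) (continuous_iterAverage hθ _ _)
      fun t _ => (ih (p + 1) _).trans (le_of_eq ?_)
    congr 2
    ring

theorem iterAverage_eq_of_eqOn (ha : ∀ j, 0 ≤ a j) {c : ℝ} (n : ℕ) : ∀ p x,
    (∀ y ∈ Set.Icc (x - ∑ j ∈ Finset.range n, a (p + j)) x, θ y = c) →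
      iterAverage a θ n p x = c := by
  induction n with
  | zero => exact fun p x h => h x (by simp)
  | succ n ih =>
    intro p x h
    refine slidingAverage_eq_of_eqOn fun t ht => ih _ _ fun y hy => h y ?_
    rw [Finset.sum_range_succ']
    have e : ∀ j, a (p + 1 + j) = a (p + (j + 1)) := fun j => by congr 1; ring
    simp only [e] at hy
    have h1 : a p * t ≤ a p := mul_le_of_le_one_right (ha p) ht.2
    have h2 : 0 ≤ a p * t := mul_nonneg (ha p) ht.1
    exact ⟨by simp only [add_zero]; linarith [hy.1], by linarith [hy.2]⟩

theorem iterAverage_mem_Icc (hθ : ∀ x y, |θ x - θ y| ≤ L * |x - y|)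
    (h01 : ∀ x, θ x ∈ Set.Icc (0 : ℝ) 1) (n : ℕ) :
    ∀ p x, iterAverage a θ n p x ∈ Set.Icc (0 : ℝ) 1 := by
  induction n with
  | zero => exact fun _ => h01
  | succ n ih =>
    intro p x
    have hc := continuous_iterAverage (a := a) hθ n (p + 1)
    have hi : IntervalIntegrable (fun t => iterAverage a θ n (p + 1) (x - a p * t)) volume 0 1 :=
      Continuous.intervalIntegrable (by fun_prop) _ _
    constructor
    · exact intervalIntegral.integral_nonneg zero_le_one fun t _ => (ih _ _).1
    · have := intervalIntegral.integral_mono (μ := volume) zero_le_one hi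
        (intervalIntegrable_const (c := (1 : ℝ))) fun t => (ih (p + 1) (x - a p * t)).2
      simpa [iterAverage, slidingAverage] using this

/-- Infinite convolution: for a summable sequence of widths the iterated averages converge to
functions `Θ p` with `Θ p' = (Θ (p + 1) - Θ (p + 1) (· - a p)) / a p`. -/
theorem exists_infinite_average (ha : ∀ j, 0 < a j) (hs : Summable a) (hL : 0 ≤ L)
    (hθ : ∀ x y, |θ x - θ y| ≤ L * |x - y|) (h01 : ∀ x, θ x ∈ Set.Icc (0 : ℝ) 1) :
    ∃ Θ : ℕ → ℝ → ℝ, (∀ p x, Θ p x ∈ Set.Icc (0 : ℝ) 1) ∧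
      (∀ p x, HasDerivAt (Θ p) ((Θ (p + 1) x - Θ (p + 1) (x - a p)) / a p) x) ∧
      ∀ x c, (∀ y ∈ Set.Icc (x - ∑' j, a j) x, θ y = c) → Θ 0 x = c := by
  have ha' : ∀ j, 0 ≤ a j := fun j => (ha j).le
  have hlim : ∀ p x, ∃ l, Filter.Tendsto (fun n => iterAverage a θ n p x) Filter.atTop (𝓝 l) := by
    intro p x
    refine cauchySeq_tendsto_of_complete (cauchySeq_of_dist_le_of_summable
      (fun n => L * a (p + n)) (fun n => ?_) ?_)
    · rw [dist_comm]
      exact abs_iterAverage_succ_sub_le ha' hL hθ n p x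
    · exact (hs.comp_injective (add_right_injective p)).mul_left L
  choose Θ hΘ using hlim
  have hLip : ∀ p x y, |Θ p x - Θ p y| ≤ L * |x - y| := fun p x y =>
    le_of_tendsto' ((hΘ p x).sub (hΘ p y)).abs fun n => iterAverage_lipschitz hθ n p x y
  have hcont : ∀ p, Continuous (Θ p) := fun p =>
    (LipschitzWith.of_dist_le' (K := L) (hLip p)).continuous
  have havg : ∀ p, Θ p = slidingAverage (a p) (Θ (p + 1)) := by
    intro p
    funext x
    refine tendsto_nhds_unique ((Filter.tendsto_add_atTop_iff_nat 1).2 (hΘ p x)) ?_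
    refine intervalIntegral.tendsto_integral_filter_of_dominated_convergence (fun _ => (1 : ℝ))
      (Filter.Eventually.of_forall fun n => ?_) (Filter.Eventually.of_forall fun n =>
        Filter.Eventually.of_forall fun t _ => ?_) intervalIntegrable_const
      (Filter.Eventually.of_forall fun t _ => hΘ (p + 1) _)
    · have := continuous_iterAverage (a := a) hθ n (p + 1)
      exact Continuous.aestronglyMeasurable (by fun_prop)
    · have := iterAverage_mem_Icc (a := a) hθ h01 n (p + 1) (x - a p * t)
      rw [Real.norm_eq_abs, abs_of_nonneg this.1]
      exact this.2
  refine ⟨Θ, fun p x => ?_, fun p x => ?_, fun x c h => ?_⟩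
  · exact isClosed_Icc.mem_of_tendsto (hΘ p x)
      (Filter.Eventually.of_forall fun n => iterAverage_mem_Icc hθ h01 n p x)
  · conv => arg 1; rw [havg p]
    exact hasDerivAt_slidingAverage (ha p).ne' (hcont _) x
  · refine tendsto_nhds_unique (hΘ 0 x) (tendsto_const_nhds.congr fun n => ?_)
    refine (iterAverage_eq_of_eqOn ha' n 0 x fun y hy => h y ⟨?_, hy.2⟩).symm
    have := hs.sum_le_tsum (Finset.range n) fun i _ => ha' i
    simp only [zero_add] at hy
    linarith [hy.1]

/-- The derivatives of an infinite convolution: each one replaces an average of width `a j` by a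
difference quotient, which costs a factor `2 / a j`. -/
theorem infinite_average_bounds {Θ : ℕ → ℝ → ℝ} (ha : ∀ j, 0 < a j)
    (h01 : ∀ p x, Θ p x ∈ Set.Icc (0 : ℝ) 1)
    (hd : ∀ p x, HasDerivAt (Θ p) ((Θ (p + 1) x - Θ (p + 1) (x - a p)) / a p) x) (n : ℕ) :
    ∀ p, ContDiff ℝ n (Θ p) ∧
      ∀ x, |iteratedDeriv n (Θ p) x| ≤ 2 ^ n / ∏ j ∈ Finset.range n, a (p + j) := by
  have hderiv : ∀ p, deriv (Θ p) = fun x => (a p)⁻¹ * (Θ (p + 1) x - Θ (p + 1) (x - a p)) :=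
    fun p => funext fun x => by rw [(hd p x).deriv]; ring
  induction n with
  | zero =>
    refine fun p => ⟨contDiff_zero.2 (continuous_iff_continuousAt.2 fun x =>
      (hd p x).continuousAt), fun x => ?_⟩
    have := h01 p x
    simp only [iteratedDeriv_zero, pow_zero, Finset.range_zero, Finset.prod_empty, div_one]
    rw [abs_of_nonneg this.1]
    exact this.2
  | succ n ih =>
    intro p
    obtain ⟨hc, hb⟩ := ih (p + 1)
    have hc' : ContDiff ℝ n fun x => Θ (p + 1) (x - a p) :=
      hc.comp (contDiff_id.sub contDiff_const)
    refine ⟨?_, fun x => ?_⟩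
    · have := contDiff_succ_iff_deriv (𝕜 := ℝ) (n := (n : WithTop ℕ∞)) (f := Θ p)
      push_cast
      rw [this]
      refine ⟨fun x => (hd p x).differentiableAt, by simp, ?_⟩
      rw [hderiv]
      exact contDiff_const.mul (hc.sub hc')
    · have hsub : iteratedDeriv n (fun x => Θ (p + 1) x - Θ (p + 1) (x - a p)) x =
          iteratedDeriv n (Θ (p + 1)) x - iteratedDeriv n (Θ (p + 1)) (x - a p) := by
        have := iteratedDeriv_sub (n := n) (x := x) hc.contDiffAt hc'.contDiffAt
        rw [iteratedDeriv_comp_sub_const] at this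
        exact this
      rw [iteratedDeriv_succ', hderiv, iteratedDeriv_const_mul _ (hc.sub hc').contDiffAt, hsub,
        abs_mul, abs_of_pos (inv_pos.2 (ha p)), Finset.prod_range_succ']
      have e : ∀ j, a (p + 1 + j) = a (p + (j + 1)) := fun j => by congr 1; ring
      simp only [e] at hb
      have hap := ha p
      calc _ ≤ (a p)⁻¹ * (2 ^ n / (∏ j ∈ Finset.range n, a (p + (j + 1))) +
            2 ^ n / (∏ j ∈ Finset.range n, a (p + (j + 1)))) := by
            gcongr
            exact (abs_sub _ _).trans (add_le_add (hb _) (hb _))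
        _ = _ := by
            have : ∏ j ∈ Finset.range n, a (p + (j + 1)) ≠ 0 :=
              Finset.prod_ne_zero_iff.2 fun j _ => (ha _).ne'
            simp only [add_zero]
            field_simp
            ring

end IteratedAverages

/-! ### Cutoff functions -/

section Cutoff

/-- A product of factors tending to zero decays faster than every geometric sequence. -/
theorem exists_prod_le_of_tendsto_zero {b : ℕ → ℝ} (hb : ∀ j, 0 ≤ b j)
    (hlim : Filter.Tendsto b Filter.atTop (𝓝 0)) {h : ℝ} (hh : 0 < h) :
    ∃ C : ℝ, 0 ≤ C ∧ ∀ n : ℕ, ∏ j ∈ Finset.range n, b j ≤ C * h ^ n := by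
  obtain ⟨N, hN⟩ := Filter.eventually_atTop.1 (hlim.eventually (gt_mem_nhds hh))
  have hnn : ∀ n, 0 ≤ (∏ j ∈ Finset.range n, b j) / h ^ n := fun n =>
    div_nonneg (Finset.prod_nonneg fun j _ => hb j) (pow_pos hh n).le
  have hstep : ∀ k, (∏ j ∈ Finset.range (N + k), b j) / h ^ (N + k) ≤
      (∏ j ∈ Finset.range N, b j) / h ^ N := by
    intro k
    induction k with
    | zero => simp
    | succ k ih =>
      rw [← add_assoc, Finset.prod_range_succ, pow_succ, mul_div_mul_comm]
      exact (mul_le_of_le_one_right (hnn _)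
        ((div_le_one hh).2 (hN _ (Nat.le_add_right _ _)).le)).trans ih
  refine ⟨∑ m ∈ Finset.range (N + 1), (∏ j ∈ Finset.range m, b j) / h ^ m,
    Finset.sum_nonneg fun m _ => hnn m, fun n => ?_⟩
  rw [← div_le_iff₀ (pow_pos hh n)]
  rcases Nat.lt_or_ge n (N + 1) with hn | hn
  · exact Finset.single_le_sum (f := fun m => (∏ j ∈ Finset.range m, b j) / h ^ m)
      (fun m _ => hnn m) (Finset.mem_range.2 hn)
  · obtain ⟨k, rfl⟩ := Nat.exists_eq_add_of_le (Nat.le_of_succ_le hn)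
    exact (hstep k).trans (Finset.single_le_sum
      (f := fun m => (∏ j ∈ Finset.range m, b j) / h ^ m) (fun m _ => hnn m)
      (Finset.mem_range.2 (Nat.lt_succ_self N)))

/-- Widths of an infinite convolution whose derivatives obey all Beurling bounds of `M`. With the
tails `t_j` of `∑ M_j / M_{j+1}` they are proportional to `√t_j - √t_{j+1}`: the sum telescopes,
and `√t_j - √t_{j+1} ≥ (M_j / M_{j+1}) / (2 √t_j)` is large compared with `M_j / M_{j+1}`. -/
theorem WeightSequence.exists_widths (M : WeightSequence) {r : ℝ} (hr : 0 < r) :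
    ∃ a : ℕ → ℝ, (∀ j, 0 < a j) ∧ Summable a ∧ ∑' j, a j ≤ r ∧
      ∀ h : ℝ, 0 < h → ∃ C : ℝ, 0 ≤ C ∧
        ∀ n : ℕ, 2 ^ n / ∏ j ∈ Finset.range n, a j ≤ C * (h ^ n * M.seq n) := by
  set ρ : ℕ → ℝ := fun j => M.seq j / M.seq (j + 1) with hρ
  have hρ0 : ∀ j, 0 < ρ j := fun j => div_pos (M.pos _) (M.pos _)
  have hs : Summable ρ := M.summable
  set t : ℕ → ℝ := fun j => ∑' i, ρ (i + j) with ht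
  have hsj : ∀ j, Summable fun i => ρ (i + j) := fun j => (summable_nat_add_iff j).2 hs
  have ht0 : ∀ j, 0 < t j := fun j => (hsj j).tsum_pos (fun i => (hρ0 _).le) 0 (hρ0 _)
  have hts : ∀ j, t j = ρ j + t (j + 1) := by
    intro j
    have := (hsj j).tsum_eq_zero_add
    simp only [zero_add] at this
    rw [ht]
    simp only
    rw [this]
    congr 2
    funext i
    congr 1
    ring
  have htl : Filter.Tendsto t Filter.atTop (𝓝 0) := tendsto_sum_nat_add ρ
  set s : ℕ → ℝ := fun j => Real.sqrt (t j) with hsdef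
  have hs0 : ∀ j, 0 < s j := fun j => Real.sqrt_pos.2 (ht0 j)
  have hsl : Filter.Tendsto s Filter.atTop (𝓝 0) := by
    simpa using htl.sqrt
  have hlt : ∀ j, s (j + 1) < s j := fun j =>
    Real.sqrt_lt_sqrt (ht0 _).le (by rw [hts j]; linarith [hρ0 j])
  have hsq : ∀ j, s j ^ 2 = t j := fun j => Real.sq_sqrt (ht0 j).le
  -- the factor that makes the sum of the widths equal to `r`
  set c : ℝ := r / s 0 with hc
  have hc0 : 0 < c := div_pos hr (hs0 0)
  have hpos : ∀ j, 0 < c * (s j - s (j + 1)) := fun j => mul_pos hc0 (sub_pos.2 (hlt j))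
  have hsum : HasSum (fun j => c * (s j - s (j + 1))) r := by
    have h1 : HasSum (fun j => s j - s (j + 1)) (s 0) := by
      rw [hasSum_iff_tendsto_nat_of_nonneg fun j => (sub_pos.2 (hlt j)).le]
      simp only [Finset.sum_range_sub']
      simpa using hsl.const_sub (s 0)
    have := h1.mul_left c
    rwa [hc, div_mul_cancel₀ _ (hs0 0).ne'] at this
  have hge : ∀ j, ρ j ≤ (2 * s j / c) * (c * (s j - s (j + 1))) := by
    intro j
    have e : (2 * s j / c) * (c * (s j - s (j + 1))) = 2 * s j * (s j - s (j + 1)) := by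
      field_simp
    have h1 := hsq j
    have h2 := hsq (j + 1)
    have h3 := hts j
    nlinarith [hlt j, hs0 j, hs0 (j + 1)]
  refine ⟨_, hpos, hsum.summable, hsum.tsum_eq.le, fun h hh => ?_⟩
  obtain ⟨C, hC, H⟩ := exists_prod_le_of_tendsto_zero (b := fun j => 2 * (2 * s j / c))
    (fun j => by have := hs0 j; positivity) (by simpa using ((hsl.const_mul 2).div_const c).const_mul 2) hh
  refine ⟨C, hC, fun n => ?_⟩
  have hprod : ∏ j ∈ Finset.range n, ρ j = (M.seq n)⁻¹ := by
    induction n with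
    | zero => simp [M.zero]
    | succ n ih =>
      rw [Finset.prod_range_succ, ih, hρ]
      have := (M.pos n).ne'
      field_simp
  have hle : (M.seq n)⁻¹ ≤ (∏ j ∈ Finset.range n, 2 * s j / c) *
      ∏ j ∈ Finset.range n, c * (s j - s (j + 1)) := by
    rw [← hprod, ← Finset.prod_mul_distrib]
    exact Finset.prod_le_prod (fun j _ => (hρ0 j).le) fun j _ => hge j
  have hP : 0 < ∏ j ∈ Finset.range n, c * (s j - s (j + 1)) := Finset.prod_pos fun j _ => hpos j
  have hn := H n
  rw [Finset.prod_mul_distrib, Finset.prod_const, Finset.card_range] at hn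
  rw [div_le_iff₀ hP]
  have hM := M.pos n
  calc (2 : ℝ) ^ n = 2 ^ n * ((M.seq n)⁻¹ * M.seq n) := by rw [inv_mul_cancel₀ hM.ne', mul_one]
    _ ≤ 2 ^ n * (((∏ j ∈ Finset.range n, 2 * s j / c) *
      ∏ j ∈ Finset.range n, c * (s j - s (j + 1))) * M.seq n) := by gcongr
    _ = (2 ^ n * ∏ j ∈ Finset.range n, 2 * s j / c) *
      (M.seq n * ∏ j ∈ Finset.range n, c * (s j - s (j + 1))) := by ring
    _ ≤ (C * h ^ n) * (M.seq n * ∏ j ∈ Finset.range n, c * (s j - s (j + 1))) := by gcongr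
    _ = _ := by ring

/-- The Denjoy–Carleman theorem: cutoff functions of Beurling class on the line. -/
theorem WeightSequence.exists_cutoff_real (M : WeightSequence) {r : ℝ} (hr : 0 < r) :
    ∃ χ : ℝ → ℝ, ContDiff ℝ ∞ χ ∧ (∀ x, χ x ∈ Set.Icc (0 : ℝ) 1) ∧ (∀ x, |x| ≤ r → χ x = 1) ∧
      (∀ x, 4 * r ≤ |x| → χ x = 0) ∧ ∀ h : ℝ, 0 < h → ∃ C : ℝ, 0 ≤ C ∧
        ∀ x : ℝ, ∀ n : ℕ, |iteratedDeriv n χ x| ≤ C * (h ^ n * M.seq n) := by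
  obtain ⟨a, ha, hs, hsum, hb⟩ := M.exists_widths hr
  -- the trapezoid equal to `1` on `[-2r, 2r]` and vanishing off `[-3r, 3r]`
  set θ : ℝ → ℝ := fun x => max 0 (min 1 (3 - |x| / r)) with hθ
  have hLip : ∀ x y, |θ x - θ y| ≤ r⁻¹ * |x - y| := by
    intro x y
    refine (abs_max_sub_max_le_max 0 _ 0 _).trans (max_le (by simpa using by positivity) ?_)
    refine (abs_min_sub_min_le_max 1 _ 1 _).trans (max_le (by simpa using by positivity) ?_)
    have e : 3 - |x| / r - (3 - |y| / r) = r⁻¹ * (|y| - |x|) := by field_simp; ring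
    rw [e, abs_mul, abs_of_pos (inv_pos.2 hr), abs_sub_comm x y]
    exact mul_le_mul_of_nonneg_left (abs_abs_sub_abs_le y x) (inv_pos.2 hr).le
  have h01 : ∀ x, θ x ∈ Set.Icc (0 : ℝ) 1 := fun x =>
    ⟨le_max_left _ _, max_le zero_le_one (min_le_left _ _)⟩
  have hone : ∀ x, |x| ≤ 2 * r → θ x = 1 := by
    intro x hx
    have : |x| / r ≤ 2 := (div_le_iff₀ hr).2 hx
    simp only [hθ]
    rw [min_eq_left (by linarith), max_eq_right zero_le_one]
  have hzero : ∀ x, 3 * r ≤ |x| → θ x = 0 := by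
    intro x hx
    have : 3 ≤ |x| / r := (le_div_iff₀ hr).2 hx
    simp only [hθ]
    rw [max_eq_left]
    exact (min_le_right _ _).trans (by linarith)
  obtain ⟨Θ, hΘ, hd, hv⟩ := exists_infinite_average ha hs (inv_pos.2 hr).le hLip h01
  have hB := infinite_average_bounds ha hΘ hd
  refine ⟨Θ 0, contDiff_infty.2 fun n => (hB n 0).1, hΘ 0, fun x hx => ?_, fun x hx => ?_,
    fun h hh => ?_⟩
  · refine hv x 1 fun y hy => hone y (abs_le.2 ?_)
    have := abs_le.1 hx
    constructor <;> linarith [hy.1, hy.2]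
  · refine hv x 0 fun y hy => hzero y (le_abs.2 ?_)
    rcases le_abs.1 hx with h | h
    · left; linarith [hy.1]
    · right; linarith [hy.2]
  · obtain ⟨C, hC, H⟩ := hb h hh
    refine ⟨C, hC, fun x n => ?_⟩
    have := (hB n 0).2 x
    simp only [zero_add] at this
    exact this.trans (H n)

variable {d : ℕ}

/-- Bump functions on balls, of Beurling class. -/
theorem exists_bump (M : WeightSequence) (Ω : TopologicalSpace.Opens (RSpace d)) {x₀ : RSpace d}
    {U : Set (RSpace d)} (hU : U ∈ 𝓝 x₀) (hUΩ : U ⊆ Ω) :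
    ∃ χ : RSpace d → ℝ, (fun x => (χ x : ℂ)) ∈ UltraTest M Ω ∧ (∀ x, χ x ∈ Set.Icc (0 : ℝ) 1) ∧
      tsupport (fun x => (χ x : ℂ)) ⊆ U ∧ ∀ᶠ x in 𝓝 x₀, χ x = 1 := by
  obtain ⟨δ, hδ, hδU⟩ := Metric.mem_nhds_iff.1 hU
  set r : ℝ := δ / (4 * (d + 1) * 2) with hr
  have hr0 : 0 < r := by positivity
  obtain ⟨η, hη, h01, h1, h0, hb⟩ := M.exists_cutoff_real hr0
  set χ : RSpace d → ℝ := fun x => ∏ j, η ((x - x₀) j) with hχ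
  have hχ01 : ∀ x, χ x ∈ Set.Icc (0 : ℝ) 1 := fun x =>
    ⟨Finset.prod_nonneg fun j _ => (h01 _).1,
      Finset.prod_le_one (fun j _ => (h01 _).1) fun j _ => (h01 _).2⟩
  have hmem : (fun x => (χ x : ℂ)) ∈ Ultradiff M Ω := by
    have e : (fun x => (χ x : ℂ)) = ∏ j : Fin d, fun x : RSpace d => ((η ((x - x₀) j) : ℝ) : ℂ) := by
      funext x
      simp [hχ, Finset.prod_apply]
    rw [e]
    have hall : ∀ s : Finset (Fin d),
        (∏ j ∈ s, fun x : RSpace d => ((η ((x - x₀) j) : ℝ) : ℂ)) ∈ Ultradiff M Ω := by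
      intro s
      induction s using Finset.cons_induction with
      | empty => exact const_mem_ultradiff (M := M) (Ω := Ω) 1
      | cons j s hj ih =>
        rw [Finset.prod_cons]
        refine mul_mem_ultradiff ?_ ih
        have := comp_mem_ultradiff (M := M) (Ω := Ω)
          (φ := fun t : ℝ => ((η (t - x₀ j) : ℝ) : ℂ))
          (Complex.ofRealCLM.contDiff.comp (hη.comp (contDiff_id.sub contDiff_const)))
          (fun h hh => ?_) (EuclideanSpace.proj j)
        · exact this
        · obtain ⟨C, hC, H⟩ := hb h hh
          refine ⟨C, hC, fun x n => ?_⟩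
          have hc : ContDiff ℝ ∞ fun t : ℝ => η (t - x₀ j) :=
            hη.comp (contDiff_id.sub contDiff_const)
          have h2 := Complex.ofRealCLM.norm_iteratedFDeriv_comp_left (hc.contDiffAt (x := x))
            (n := n) (by exact_mod_cast le_top)
          rw [Complex.ofRealCLM_norm, one_mul, norm_iteratedFDeriv_eq_norm_iteratedDeriv
            (f := fun t : ℝ => η (t - x₀ j)), iteratedDeriv_comp_sub_const] at h2
          exact h2.trans (H _ n)
    exact hall _
  have hball : tsupport (fun x => (χ x : ℂ)) ⊆ Metric.closedBall x₀ (δ / 2) := by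
    refine closure_minimal (fun x hx => ?_) Metric.isClosed_closedBall
    have hx' : χ x ≠ 0 := by simpa using hx
    have hj : ∀ j, |(x - x₀) j| ≤ 4 * r := by
      intro j
      by_contra hj
      exact Finset.prod_ne_zero_iff.1 hx' j (Finset.mem_univ j) (h0 _ (not_le.1 hj).le)
    rw [Metric.mem_closedBall, dist_eq_norm, EuclideanSpace.norm_eq]
    refine Real.sqrt_le_iff.2 ⟨by positivity, ?_⟩
    calc ∑ i, ‖(x - x₀) i‖ ^ 2 ≤ ∑ _i : Fin d, (4 * r) ^ 2 := by
          gcongr with i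
          exact hj i
      _ = d * (4 * r) ^ 2 := by simp
      _ ≤ (d + 1) ^ 2 * (4 * r) ^ 2 := by
          gcongr
          nlinarith [(Nat.cast_nonneg d : (0 : ℝ) ≤ d)]
      _ = (δ / 2) ^ 2 := by rw [hr]; field_simp
  have hsub : tsupport (fun x => (χ x : ℂ)) ⊆ U :=
    hball.trans ((Metric.closedBall_subset_ball (by linarith)).trans hδU)
  refine ⟨χ, ⟨hmem, ?_, hsub.trans hUΩ⟩, hχ01, hsub, ?_⟩
  · exact (isCompact_closedBall x₀ (δ / 2)).of_isClosed_subset (isClosed_tsupport _) hball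
  · filter_upwards [Metric.ball_mem_nhds x₀ hr0] with x hx
    refine Finset.prod_eq_one fun j _ => h1 _ ?_
    have := PiLp.norm_apply_le (x - x₀) j
    rw [Metric.mem_ball, dist_eq_norm] at hx
    exact this.trans hx.le

/-- Cutoff functions of Beurling class for compact sets. -/
theorem exists_cutoff (M : WeightSequence) (Ω : TopologicalSpace.Opens (RSpace d))
    {K : Set (RSpace d)} (hK : IsCompact K) (hKΩ : K ⊆ Ω) :
    ∃ χ ∈ UltraTest M Ω, ∃ U : Set (RSpace d), IsOpen U ∧ K ⊆ U ∧ ∀ x ∈ U, χ x = 1 := by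
  refine hK.induction_on (p := fun S => ∃ χ ∈ UltraTest M Ω, ∃ U : Set (RSpace d), IsOpen U ∧
    S ⊆ U ∧ ∀ x ∈ U, χ x = 1) ?_ ?_ ?_ ?_
  · exact ⟨0, zero_mem _, ∅, isOpen_empty, le_rfl, by simp⟩
  · rintro S S' hS ⟨χ, hχ, U, hU, hSU, h1⟩
    exact ⟨χ, hχ, U, hU, hS.trans hSU, h1⟩
  · rintro S S' ⟨χ, hχ, U, hU, hSU, h1⟩ ⟨χ', hχ', U', hU', hSU', h1'⟩
    -- `1 - (1 - χ) (1 - χ')` equals `1` wherever `χ` or `χ'` does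
    refine ⟨χ + χ' - χ * χ', sub_mem (add_mem hχ hχ') (mul_mem_ultraTest hχ.1 hχ'), U ∪ U',
      hU.union hU', Set.union_subset_union hSU hSU', ?_⟩
    rintro x (hx | hx)
    · simp [h1 x hx]
    · simp [h1' x hx]
  · intro x hx
    obtain ⟨χ, hχ, -, -, h1⟩ := exists_bump M Ω (Ω.isOpen.mem_nhds (hKΩ hx)) le_rfl
    obtain ⟨U, hU1, hU, hxU⟩ := eventually_nhds_iff.1 h1
    exact ⟨U, mem_nhdsWithin_of_mem_nhds (hU.mem_nhds hxU), _, hχ, U, hU, le_rfl,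
      fun y hy => by simp [hU1 y hy]⟩

end Cutoff

/-! ### Uniform boundedness on test functions -/

section Pairing

variable {d : ℕ} {M : WeightSequence} {Ω : TopologicalSpace.Opens (RSpace d)}
  {K : Set (RSpace d)} {f g : RSpace d → ℂ}

theorem pairing_eq_integral (f : RSpace d → ℂ) (φ : UltraTest M Ω) :
    pairing f φ = ∫ x, f x * (φ : RSpace d → ℂ) x := by
  refine setIntegral_eq_integral_of_forall_compl_eq_zero fun x hx => ?_
  rw [image_eq_zero_of_notMem_tsupport fun h => hx (φ.2.2.2 h), mul_zero]

theorem integrable_mul (hf : f ∈ Ultradiff M Ω) (φ : UltraTest M Ω) :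
    Integrable fun x => f x * (φ : RSpace d → ℂ) x := by
  have h := mul_mem_ultraTest hf φ.2
  exact (contDiff_of_mem_ultraTest h).continuous.integrable_of_hasCompactSupport h.2.1

/-- The linear form `φ ↦ ⟨f, φ⟩`. -/
def pairingLM (hf : f ∈ Ultradiff M Ω) : UltraTest M Ω →ₗ[ℂ] ℂ where
  toFun := pairing f
  map_add' φ ψ := by
    simp only [pairing_eq_integral]
    rw [← integral_add (integrable_mul hf φ) (integrable_mul hf ψ)]
    simp [mul_add]
  map_smul' c φ := by
    simp only [pairing_eq_integral]
    rw [RingHom.id_apply, smul_eq_mul, ← integral_const_mul]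
    congr 1
    funext x
    simp
    ring

theorem pairingLM_apply (hf : f ∈ Ultradiff M Ω) (φ : UltraTest M Ω) :
    pairingLM hf φ = pairing f φ := rfl

theorem pairing_sub (hf : f ∈ Ultradiff M Ω) (hg : g ∈ Ultradiff M Ω) (φ : UltraTest M Ω) :
    pairing (f - g) φ = pairing f φ - pairing g φ := by
  simp only [pairing_eq_integral]
  rw [← integral_sub (integrable_mul hf φ) (integrable_mul hg φ)]
  simp [sub_mul]

theorem norm_pairing_le (hK : IsCompact K) {φ : UltraTest M Ω}
    (hφ : tsupport (φ : RSpace d → ℂ) ⊆ K) {A B : ℝ} (hf : ∀ x ∈ K, ‖f x‖ ≤ A)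
    (hB : ∀ x, ‖(φ : RSpace d → ℂ) x‖ ≤ B) : ‖pairing f φ‖ ≤ A * B * volume.real K := by
  have e : pairing f φ = ∫ x in K, f x * (φ : RSpace d → ℂ) x := by
    rw [pairing_eq_integral]
    refine (setIntegral_eq_integral_of_forall_compl_eq_zero fun x hx => ?_).symm
    rw [image_eq_zero_of_notMem_tsupport fun h => hx (hφ h), mul_zero]
  rw [e]
  refine norm_setIntegral_le_of_norm_le_const hK.measure_lt_top fun x hx => ?_
  rw [norm_mul]
  have h1 := hf x hx
  have h2 := hB x
  have h3 : 0 ≤ A := (norm_nonneg _).trans h1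
  gcongr

end Pairing

section UniformBoundedness

variable {d : ℕ} {M : WeightSequence} {Ω : TopologicalSpace.Opens (RSpace d)}
  {K : Set (RSpace d)}

theorem GaugeLE.mono {h h' B B' : ℝ} {φ : RSpace d → ℂ} (H : GaugeLE M h B φ) (hh : 0 ≤ h)
    (hh' : h ≤ h') (hB : 0 ≤ B) (hB' : B ≤ B') : GaugeLE M h' B' φ := by
  intro x n
  have := (M.pos n).le
  refine (H x n).trans ?_
  gcongr
  exact hB.trans hB'

theorem GaugeLE.norm_le {h B : ℝ} {φ : RSpace d → ℂ} (H : GaugeLE M h B φ) (x : RSpace d) :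
    ‖φ x‖ ≤ B := by
  simpa [M.zero] using H x 0

theorem GaugeLE.const_smul {h B : ℝ} {φ : RSpace d → ℂ} (H : GaugeLE M h B φ)
    (hφ : ContDiff ℝ ∞ φ) (c : ℂ) : GaugeLE M h (‖c‖ * B) (c • φ) := by
  intro x n
  rw [iteratedFDeriv_const_smul_apply (hφ.contDiffAt.of_le (by exact_mod_cast le_top)), norm_smul,
    mul_assoc]
  exact mul_le_mul_of_nonneg_left (H x n) (norm_nonneg c)

/-- Continuity on `𝒟^{(M_p)}(K)` of a linear form, in terms of gauge bounds. -/
def ContinuousOnTest (K : Set (RSpace d)) (F : UltraTest M Ω →ₗ[ℂ] ℂ) : Prop :=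
  ∃ h : ℝ, 0 < h ∧ ∃ C : ℝ, 0 ≤ C ∧ ∀ φ : UltraTest M Ω, tsupport (φ : RSpace d → ℂ) ⊆ K →
    ∀ B : ℝ, 0 ≤ B → GaugeLE M h B (φ : RSpace d → ℂ) → ‖F φ‖ ≤ C * B

theorem ContinuousOnTest.sub {F G : UltraTest M Ω →ₗ[ℂ] ℂ} (hF : ContinuousOnTest K F)
    (hG : ContinuousOnTest K G) : ContinuousOnTest K (F - G) := by
  obtain ⟨h, hh, C, hC, H⟩ := hF
  obtain ⟨h', hh', C', hC', H'⟩ := hG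
  refine ⟨min h h', lt_min hh hh', C + C', add_nonneg hC hC', fun φ hφ B hB hg => ?_⟩
  rw [add_mul, LinearMap.sub_apply]
  exact (norm_sub_le _ _).trans (add_le_add
    (H φ hφ B hB (hg.mono (lt_min hh hh').le (min_le_left _ _) hB le_rfl))
    (H' φ hφ B hB (hg.mono (lt_min hh hh').le (min_le_right _ _) hB le_rfl)))

theorem ContinuousOnTest.smul {F : UltraTest M Ω →ₗ[ℂ] ℂ} (hF : ContinuousOnTest K F) (c : ℂ) :
    ContinuousOnTest K (c • F) := by
  obtain ⟨h, hh, C, hC, H⟩ := hF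
  refine ⟨h, hh, ‖c‖ * C, by positivity, fun φ hφ B hB hg => ?_⟩
  rw [LinearMap.smul_apply, norm_smul, mul_assoc]
  exact mul_le_mul_of_nonneg_left (H φ hφ B hB hg) (norm_nonneg c)

theorem IsUltradistribution.continuousOnTest {T : UltraTest M Ω →ₗ[ℂ] ℂ}
    (hT : IsUltradistribution T) (hK : IsCompact K) (hKΩ : K ⊆ Ω) : ContinuousOnTest K T := by
  obtain ⟨h, hh, C, hC, H⟩ := hT K hK hKΩ
  refine ⟨h, hh, C, hC, fun φ hφ B hB hg => ?_⟩
  have := (H φ hφ).trans (mul_le_mul_right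
    (unorm_le_of_norm_iteratedFDeriv_le hh hB fun x _ n => hg x n) _)
  rwa [← ENNReal.ofReal_mul hC, ← ofReal_norm, ENNReal.ofReal_le_ofReal_iff (by positivity)] at this

theorem continuousOnTest_pairingLM (hK : IsCompact K) (hKΩ : K ⊆ Ω) {f : RSpace d → ℂ}
    (hf : f ∈ Ultradiff M Ω) : ContinuousOnTest K (pairingLM hf) := by
  obtain ⟨A, hA⟩ := hK.exists_bound_of_continuousOn (hf.1.continuousOn.mono hKΩ)
  refine ⟨1, one_pos, |A| * volume.real K, by positivity, fun φ hφ B hB hg => ?_⟩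
  have := norm_pairing_le (f := f) hK hφ (fun x hx => (hA x hx).trans (le_abs_self A)) hg.norm_le
  rw [pairingLM_apply]
  linarith

/-- An absolutely convergent series `∑ a_j φ_j` over a bounded sequence in `𝒟^{(M_p)}(K)`. -/
theorem tsum_smul_gaugeLE {φ : ℕ → RSpace d → ℂ} (hφ : ∀ j, ContDiff ℝ ∞ (φ j)) {a : ℕ → ℂ}
    (ha : Summable fun j => ‖a j‖) {h S : ℝ} (H : ∀ j, GaugeLE M h S (φ j)) :
    ContDiff ℝ ∞ (fun x => ∑' j, (a j • φ j) x) ∧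
      GaugeLE M h ((∑' j, ‖a j‖) * S) (fun x => ∑' j, (a j • φ j) x) := by
  have hc : ∀ j, ContDiff ℝ ((⊤ : ℕ∞) : WithTop ℕ∞) (a j • φ j) := fun j => (hφ j).const_smul (a j)
  have hb : ∀ (k : ℕ) (j : ℕ) (x : RSpace d), ((k : ℕ∞) ≤ (⊤ : ℕ∞)) →
      ‖iteratedFDeriv ℝ k (a j • φ j) x‖ ≤ ‖a j‖ * (S * (h ^ k * M.seq k)) := by
    intro k j x _
    have := (H j).const_smul (hφ j) (a j) x k
    rwa [mul_assoc] at this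
  have hs : ∀ k : ℕ, ((k : ℕ∞) ≤ (⊤ : ℕ∞)) →
      Summable fun j => ‖a j‖ * (S * (h ^ k * M.seq k)) := fun k _ => ha.mul_right _
  refine ⟨contDiff_tsum hc hs hb, fun x n => ?_⟩
  rw [iteratedFDeriv_tsum_apply hc hs hb le_top x]
  refine (tsum_of_norm_bounded (hs n le_top).hasSum fun j => hb n j x le_top).trans (le_of_eq ?_)
  rw [tsum_mul_right, mul_assoc]

/-- The uniform boundedness principle along a bounded sequence of test functions: it is the
Banach–Steinhaus theorem on `ℓ^1`, transported by `a ↦ ∑ a_j φ_j`. -/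
theorem exists_bound_of_pointwise_bounded (hK : IsCompact K) (hKΩ : K ⊆ Ω)
    {F : ℕ → UltraTest M Ω →ₗ[ℂ] ℂ} (hF : ∀ n, ContinuousOnTest K (F n))
    (hpt : ∀ φ : UltraTest M Ω, tsupport (φ : RSpace d → ℂ) ⊆ K → ∃ C : ℝ, ∀ n, ‖F n φ‖ ≤ C)
    {φ : ℕ → UltraTest M Ω} (hφK : ∀ n, tsupport (φ n : RSpace d → ℂ) ⊆ K)
    (hφ : ∀ h : ℝ, 0 < h → ∃ S : ℝ, 0 ≤ S ∧ ∀ n, GaugeLE M h S (φ n : RSpace d → ℂ)) :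
    ∃ C : ℝ, ∀ n, ‖F n (φ n)‖ ≤ C := by
  have hone : (0 : ℝ) < (1 : ℝ≥0∞).toReal := by simp
  have hsum : ∀ a : lp (fun _ : ℕ => ℂ) 1, Summable fun j => ‖a j‖ := fun a => by
    simpa using (lp.memℓp a).summable hone
  have hnorm : ∀ a : lp (fun _ : ℕ => ℂ) 1, ‖a‖ = ∑' j, ‖a j‖ := fun a => by
    simpa using lp.norm_eq_tsum_rpow hone a
  have hsm : ∀ j, ContDiff ℝ ∞ (φ j : RSpace d → ℂ) := fun j => contDiff_of_mem_ultraTest (φ j).2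
  have hts : ∀ a : lp (fun _ : ℕ => ℂ) 1,
      tsupport (fun x => ∑' j, (a j • (φ j : RSpace d → ℂ)) x) ⊆ K := by
    intro a
    refine closure_minimal (fun x hx => ?_) hK.isClosed
    by_contra hxK
    refine hx ?_
    have : ∀ j, (φ j : RSpace d → ℂ) x = 0 := fun j =>
      image_eq_zero_of_notMem_tsupport fun h => hxK (hφK j h)
    simp [this]
  have hmem : ∀ a : lp (fun _ : ℕ => ℂ) 1,
      (fun x => ∑' j, (a j • (φ j : RSpace d → ℂ)) x) ∈ UltraTest M Ω := by
    intro a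
    refine ⟨mem_ultradiff_iff.2 ⟨?_, fun L _ _ h hh => ?_⟩, hK.of_isClosed_subset
      (isClosed_tsupport _) (hts a), (hts a).trans hKΩ⟩
    · obtain ⟨S, -, HS⟩ := hφ 1 one_pos
      exact (tsum_smul_gaugeLE hsm (hsum a) HS).1.contDiffOn
    · obtain ⟨S, hS, HS⟩ := hφ h hh
      exact ⟨_, mul_nonneg (tsum_nonneg fun _ => norm_nonneg _) hS,
        fun x _ n => (tsum_smul_gaugeLE hsm (hsum a) HS).2 x n⟩
  have hpsum : ∀ (a : lp (fun _ : ℕ => ℂ) 1) (x : RSpace d),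
      Summable fun j => (a j • (φ j : RSpace d → ℂ)) x := by
    intro a x
    obtain ⟨S, -, HS⟩ := hφ 1 one_pos
    refine Summable.of_norm_bounded ((hsum a).mul_right S) fun j => ?_
    rw [Pi.smul_apply, norm_smul]
    exact mul_le_mul_of_nonneg_left ((HS j).norm_le x) (norm_nonneg _)
  let Φ : lp (fun _ : ℕ => ℂ) 1 →ₗ[ℂ] UltraTest M Ω :=
    { toFun := fun a => ⟨_, hmem a⟩
      map_add' := fun a b => by
        ext x
        simp only [Submodule.coe_add, Pi.add_apply]
        rw [← (hpsum a x).tsum_add (hpsum b x)]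
        simp [add_mul]
      map_smul' := fun c a => by
        ext x
        simp only [Submodule.coe_smul, Pi.smul_apply, RingHom.id_apply, smul_eq_mul]
        rw [← tsum_mul_left]
        simp [mul_assoc] }
  have hG : ∀ n, ∃ C : ℝ, ∀ a, ‖(F n ∘ₗ Φ) a‖ ≤ C * ‖a‖ := by
    intro n
    obtain ⟨h, hh, C, hC, H⟩ := hF n
    obtain ⟨S, hS, HS⟩ := hφ h hh
    refine ⟨C * S, fun a => ?_⟩
    have := H (Φ a) (hts a) _ (mul_nonneg (tsum_nonneg fun _ => norm_nonneg _) hS)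
      (tsum_smul_gaugeLE hsm (hsum a) HS).2
    rw [LinearMap.comp_apply, hnorm]
    linarith
  choose c hc using hG
  obtain ⟨C, hC⟩ := banach_steinhaus (g := fun n => (F n ∘ₗ Φ).mkContinuous (c n) (hc n))
    fun a => by
      obtain ⟨C, hC⟩ := hpt (Φ a) (hts a)
      exact ⟨C, fun n => hC n⟩
  refine ⟨C, fun n => ?_⟩
  have hn := ((F n ∘ₗ Φ).mkContinuous (c n) (hc n)).le_of_opNorm_le (hC n)
    (lp.single 1 n (1 : ℂ))
  have hΦ : Φ (lp.single 1 n (1 : ℂ)) = φ n := by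
    ext x
    change ∑' j, _ = _
    rw [tsum_eq_single n]
    · simp
    · intro j hj
      simp [lp.single_apply, hj]
  rw [LinearMap.mkContinuous_apply, LinearMap.comp_apply, hΦ, lp.norm_single (by simp)] at hn
  simpa using hn

/-- Strong association holds uniformly on bounded sets of test functions. -/
theorem exists_uniform_association {u : NetIndex → RSpace d → ℂ} (hu : ∀ ε, u ε ∈ Ultradiff M Ω)
    {T : UltraTest M Ω →ₗ[ℂ] ℂ} (hT : IsUltradistribution T) (hK : IsCompact K) (hKΩ : K ⊆ Ω)
    {b : ℝ} (H : ∀ φ : UltraTest M Ω, tsupport (φ : RSpace d → ℂ) ⊆ K →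
      NetBigO (fun ε => ‖pairing (u ε) φ - T φ‖ₑ) fun ε => Real.exp (-M.assoc (b / ε))) :
    ∃ h : ℝ, 0 < h ∧ ∃ C : ℝ, 0 ≤ C ∧ ∃ ε₀ : NetIndex, ∀ ε < ε₀, ∀ φ : UltraTest M Ω,
      tsupport (φ : RSpace d → ℂ) ⊆ K → ∀ B : ℝ, 0 ≤ B → GaugeLE M h B (φ : RSpace d → ℂ) →
        M.expAssoc (b / ε) * ‖pairing (u ε) φ - T φ‖ ≤ C * B := by
  -- otherwise there are `ε_n → 0` and a sequence `φ_n / B_n`, bounded in `𝒟^{(M_p)}(K)`, on which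
  -- the forms `E(b/ε_n) (⟨u_{ε_n}, ·⟩ - T)` are unbounded
  by_contra! hcon
  have hδ : ∀ n : ℕ, ((n : ℝ) + 2)⁻¹ ∈ Set.Ioo (0 : ℝ) 1 := fun n =>
    ⟨by positivity, inv_lt_one_of_one_lt₀ (by linarith [(Nat.cast_nonneg n : (0 : ℝ) ≤ n)])⟩
  have hn0 : ∀ n : ℕ, (0 : ℝ) < n + 1 := fun n => by positivity
  choose ε hε φ hφK B hB hφB hlt using fun n : ℕ => hcon ((n : ℝ) + 1)⁻¹ (inv_pos.2 (hn0 n)) n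
    (Nat.cast_nonneg n) ⟨_, hδ n⟩
  have hBpos : ∀ n, 0 < B n := by
    intro n
    refine (hB n).lt_of_ne' fun h0 => ?_
    have hz : φ n = 0 := by
      ext x
      have := (hφB n).norm_le x
      rw [h0] at this
      simpa using this
    have h1 := hlt n
    rw [← pairingLM_apply (hu _), hz, h0] at h1
    simp at h1
  let F : ℕ → UltraTest M Ω →ₗ[ℂ] ℂ := fun n =>
    ((M.expAssoc (b / ε n) : ℝ) : ℂ) • (pairingLM (hu (ε n)) - T)
  have hFn : ∀ n (ψ : UltraTest M Ω),
      ‖F n ψ‖ = M.expAssoc (b / ε n) * ‖pairing (u (ε n)) ψ - T ψ‖ := by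
    intro n ψ
    rw [LinearMap.smul_apply, norm_smul, Complex.norm_real, Real.norm_eq_abs,
      abs_of_pos (M.expAssoc_pos _)]
    rfl
  have hbdd : ∀ s : ℕ → ℝ, (∃ N : ℕ, ∃ C : ℝ, ∀ n ≥ N, s n ≤ C) → ∃ C : ℝ, 0 ≤ C ∧ ∀ n, s n ≤ C := by
    rintro s ⟨N, C, hC⟩
    obtain ⟨C', hC'⟩ := Filter.IsBoundedUnder.bddAbove_range (f := s)
      ⟨C, Filter.eventually_map.2 (Filter.eventually_atTop.2 ⟨N, hC⟩)⟩
    exact ⟨max 0 C', le_max_left _ _, fun n => (hC' ⟨n, rfl⟩).trans (le_max_right _ _)⟩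
  have hsmall : ∀ η : ℝ, 0 < η → ∃ N : ℕ, ∀ n ≥ N, ((n : ℝ) + 1)⁻¹ ≤ η := by
    intro η hη
    obtain ⟨N, hN⟩ := exists_nat_gt η⁻¹
    refine ⟨N, fun n hn => ?_⟩
    have : (N : ℝ) ≤ n := Nat.cast_le.2 hn
    exact inv_le_of_inv_le₀ hη (by linarith)
  obtain ⟨C, hC⟩ := exists_bound_of_pointwise_bounded hK hKΩ (F := F)
    (φ := fun n => ((B n)⁻¹ : ℂ) • φ n)
    (fun n => ((continuousOnTest_pairingLM hK hKΩ _).sub (hT.continuousOnTest hK hKΩ)).smul _)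
    (fun ψ hψ => by
      obtain ⟨C, hC, ε₀, hε₀⟩ := H ψ hψ
      obtain ⟨N, hN⟩ := hsmall ε₀ ε₀.2.1
      have hev : ∀ n ≥ N, ‖F n ψ‖ ≤ C := by
        intro n hn
        have h1 : ε n < ε₀ := by
          refine (hε n).trans_le (Subtype.coe_le_coe.1 (le_trans ?_ (hN n hn)))
          exact inv_anti₀ (hn0 n) (by linarith)
        have h2 := hε₀ _ h1
        dsimp only at h2
        rw [M.exp_neg_assoc, ← ofReal_norm, ENNReal.ofReal_le_ofReal_iff
          (mul_nonneg hC (inv_pos.2 (M.expAssoc_pos _)).le), ← div_eq_mul_inv,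
          le_div_iff₀ (M.expAssoc_pos _)] at h2
        rw [hFn]
        linarith
      obtain ⟨C', -, hC'⟩ := hbdd (fun n => ‖F n ψ‖) ⟨N, C, hev⟩
      exact ⟨C', hC'⟩)
    (fun n => (tsupport_smul_subset_right (fun _ => ((B n)⁻¹ : ℂ)) _).trans (hφK n))
    (fun h hh => by
      have hg : ∀ n : ℕ, GaugeLE M ((n : ℝ) + 1)⁻¹ 1
          ((((B n)⁻¹ : ℂ) • φ n : UltraTest M Ω) : RSpace d → ℂ) := by
        intro n
        have := (hφB n).const_smul (contDiff_of_mem_ultraTest (φ n).2) ((B n)⁻¹ : ℂ)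
        rw [norm_inv, Complex.norm_real, Real.norm_eq_abs, abs_of_pos (hBpos n),
          inv_mul_cancel₀ (hBpos n).ne'] at this
        exact this
      choose S hS HS using fun n => exists_gaugeLE (((B n)⁻¹ : ℂ) • φ n : UltraTest M Ω).2 hh
      obtain ⟨N, hN⟩ := hsmall h hh
      have hfin : ∀ n, ∃ s : ℝ, (n ≥ N → s ≤ 1) ∧ 0 ≤ s ∧
          GaugeLE M h s ((((B n)⁻¹ : ℂ) • φ n : UltraTest M Ω) : RSpace d → ℂ) := by
        intro n
        by_cases hn : n ≥ N
        · exact ⟨1, fun _ => le_rfl, zero_le_one,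
            (hg n).mono (inv_pos.2 (hn0 n)).le (hN n hn) zero_le_one le_rfl⟩
        · exact ⟨S n, fun h => absurd h hn, hS n, HS n⟩
      choose s hs1 hs0 hs using hfin
      obtain ⟨C, hC, hC'⟩ := hbdd s ⟨N, 1, hs1⟩
      exact ⟨C, hC, fun n => (hs n).mono hh.le le_rfl (hs0 n) (hC' n)⟩)
  obtain ⟨n, hn⟩ := exists_nat_gt C
  have h1 := hC n
  rw [map_smul, norm_smul, hFn, norm_inv, Complex.norm_real, Real.norm_eq_abs,
    abs_of_pos (hBpos n), inv_mul_le_iff₀ (hBpos n)] at h1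
  have h2 := hlt n
  nlinarith [hBpos n]

end UniformBoundedness

/-! ### Rapid decay and the Fourier transform -/

section FourierDecay

open scoped FourierTransform

variable {d : ℕ} {M : WeightSequence} {Ω : TopologicalSpace.Opens (RSpace d)}
  {K : Set (RSpace d)}

/-- Decay of Beurling type, `τ(ξ) = O(e^{-M(|ξ|/h)})` for every `h > 0`, in terms of powers. -/
def RapidDecay (M : WeightSequence) (τ : RSpace d → ℂ) : Prop :=
  ∀ h : ℝ, 0 < h → ∃ C : ℝ, 0 ≤ C ∧ ∀ (n : ℕ) (ξ : RSpace d),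
    ‖ξ‖ ^ n * ‖τ ξ‖ ≤ C * (h ^ n * M.seq n)

/-- By (M.2), decay against all powers absorbs a factor `e^{M(ρ/(hH))}`. -/
theorem WeightSequence.pow_mul_expAssoc_le {c H : ℝ} (hH : 1 ≤ H)
    (hM2 : ∀ p q : ℕ, M.seq (p + q) ≤ c * H ^ (p + q) * (M.seq p * M.seq q)) {h ρ X A : ℝ}
    (hh : 0 < h) (hρ : 0 ≤ ρ) (hX : 0 ≤ X) (hA : ∀ n : ℕ, ρ ^ n * X ≤ A * (h ^ n * M.seq n)) (m : ℕ) :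
    ρ ^ m * X * M.expAssoc (ρ / (h * H)) ≤ c * A * ((h * H) ^ m * M.seq m) := by
  have hH0 : 0 < H := by linarith
  have hA0 : 0 ≤ A := by
    have := hA 0
    simp only [pow_zero, one_mul, M.zero, mul_one] at this
    linarith
  have key : ∀ q : ℕ, (ρ ^ m * X) * (ρ / (h * H)) ^ q ≤
      c * A * ((h * H) ^ m * M.seq m) * M.seq q := by
    intro q
    have hp := M.gauge_pos hh (m + q)
    rw [div_pow, ← mul_div_assoc, div_le_iff₀ (by positivity)]
    calc ρ ^ m * X * ρ ^ q = ρ ^ (m + q) * X := by rw [pow_add]; ring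
      _ ≤ A * (h ^ (m + q) * M.seq (m + q)) := hA _
      _ ≤ A * (h ^ (m + q) * (c * H ^ (m + q) * (M.seq m * M.seq q))) := by
          gcongr
          exact hM2 m q
      _ = _ := by rw [mul_pow, mul_pow, pow_add, pow_add]; ring
  rcases (mul_nonneg (pow_nonneg hρ m) hX).eq_or_lt with h0 | h0
  · have := key 0
    rw [← h0] at this ⊢
    simpa [M.zero] using this
  · rw [mul_comm, ← le_div_iff₀ h0]
    refine M.expAssoc_le (by positivity) fun q => ?_
    rw [div_mul_eq_mul_div, le_div_iff₀ h0, mul_comm]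
    exact key q

theorem RapidDecay.expAssoc_mul {τ : RSpace d → ℂ} (hτ : RapidDecay M τ) {κ : ℝ} (hκ : 0 ≤ κ) :
    RapidDecay M fun ξ => (M.expAssoc (κ * ‖ξ‖) : ℂ) * τ ξ := by
  obtain ⟨c, H, hc, hH, hM2⟩ := M.exists_seq_add_le
  have hH0 : 0 < H := by linarith
  intro h hh
  set η : ℝ := min h (κ + 1)⁻¹ with hη
  have hη0 : 0 < η := lt_min hh (by positivity)
  obtain ⟨A, hA, HA⟩ := hτ (η / H) (by positivity)
  refine ⟨c * A, by positivity, fun n ξ => ?_⟩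
  have h1 := M.pow_mul_expAssoc_le hH hM2 (by positivity) (norm_nonneg ξ) (norm_nonneg (τ ξ))
    (fun m => HA m ξ) n
  rw [div_mul_cancel₀ _ hH0.ne'] at h1
  have h2 : M.expAssoc (κ * ‖ξ‖) ≤ M.expAssoc (‖ξ‖ / η) := by
    refine M.expAssoc_mono (by positivity) ?_
    rw [div_eq_inv_mul]
    gcongr
    have : κ + 1 ≤ η⁻¹ := by
      rw [le_inv_comm₀ (by positivity) hη0]
      exact min_le_right _ _
    linarith
  have hp := M.pos n
  rw [norm_mul, Complex.norm_real, Real.norm_eq_abs, abs_of_pos (M.expAssoc_pos _)]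
  calc ‖ξ‖ ^ n * (M.expAssoc (κ * ‖ξ‖) * ‖τ ξ‖)
      ≤ ‖ξ‖ ^ n * (M.expAssoc (‖ξ‖ / η) * ‖τ ξ‖) := by gcongr
    _ = ‖ξ‖ ^ n * ‖τ ξ‖ * M.expAssoc (‖ξ‖ / η) := by ring
    _ ≤ c * A * (η ^ n * M.seq n) := h1
    _ ≤ c * A * (h ^ n * M.seq n) := by
        gcongr
        exact min_le_left _ _

theorem RapidDecay.comp_neg {τ : RSpace d → ℂ} (hτ : RapidDecay M τ) :
    RapidDecay M fun ξ => τ (-ξ) := by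
  intro h hh
  obtain ⟨C, hC, H⟩ := hτ h hh
  exact ⟨C, hC, fun n ξ => by simpa using H n (-ξ)⟩

/-- The integrable weight `(1 + |ξ|)^{-(d+1)}` can be split off. -/
theorem RapidDecay.exists_integrable_bound {τ : RSpace d → ℂ} (hτ : RapidDecay M τ) {h : ℝ}
    (hh : 0 < h) : ∃ C : ℝ, 0 ≤ C ∧ ∀ (n : ℕ) (ξ : RSpace d),
      ‖ξ‖ ^ n * ‖τ ξ‖ ≤ C * (h ^ n * M.seq n) * (1 + ‖ξ‖) ^ (-((d + 1 : ℕ) : ℝ)) := by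
  obtain ⟨c, H, hc, hH, hM2⟩ := M.exists_seq_add_le
  have hH0 : 0 < H := by linarith
  set N := d + 1
  obtain ⟨A, hA, HA⟩ := hτ (h / H) (by positivity)
  have hMN := M.pos N
  refine ⟨2 ^ N * A * (1 + c * h ^ N * M.seq N), by positivity, fun n ξ => ?_⟩
  set ρ := ‖ξ‖
  have hρ : 0 ≤ ρ := norm_nonneg ξ
  rw [Real.rpow_neg (by positivity), Real.rpow_natCast, ← div_eq_mul_inv,
    le_div_iff₀ (by positivity)]
  have h1 : (1 + ρ) ^ N ≤ 2 ^ N * (1 + ρ ^ N) := by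
    have : 1 + ρ ≤ 2 * max 1 ρ := by linarith [le_max_left 1 ρ, le_max_right 1 ρ]
    calc (1 + ρ) ^ N ≤ (2 * max 1 ρ) ^ N := by gcongr
      _ = 2 ^ N * (max 1 ρ) ^ N := mul_pow _ _ _
      _ ≤ _ := by
        gcongr
        rcases max_cases 1 ρ with ⟨e, _⟩ | ⟨e, _⟩ <;> rw [e]
        · rw [one_pow]; linarith [pow_nonneg hρ N]
        · linarith
  have hMn := M.pos n
  have h2 : (h / H) ^ n ≤ h ^ n := by
    gcongr
    exact div_le_self hh.le hH
  have h3 : (h / H) ^ (n + N) * M.seq (n + N) ≤ c * (h ^ n * h ^ N) * (M.seq n * M.seq N) := by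
    calc _ ≤ (h / H) ^ (n + N) * (c * H ^ (n + N) * (M.seq n * M.seq N)) := by
          gcongr
          exact hM2 n N
      _ = c * ((h / H) * H) ^ (n + N) * (M.seq n * M.seq N) := by rw [mul_pow]; ring
      _ = _ := by rw [div_mul_cancel₀ _ hH0.ne', pow_add]
  calc ρ ^ n * ‖τ ξ‖ * (1 + ρ) ^ N ≤ ρ ^ n * ‖τ ξ‖ * (2 ^ N * (1 + ρ ^ N)) := by gcongr
    _ = 2 ^ N * (ρ ^ n * ‖τ ξ‖ + ρ ^ (n + N) * ‖τ ξ‖) := by rw [pow_add]; ring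
    _ ≤ 2 ^ N * (A * ((h / H) ^ n * M.seq n) + A * ((h / H) ^ (n + N) * M.seq (n + N))) := by
        exact mul_le_mul_of_nonneg_left (add_le_add (HA n ξ) (HA (n + N) ξ)) (by positivity)
    _ ≤ 2 ^ N * (A * (h ^ n * M.seq n) + A * (c * (h ^ n * h ^ N) * (M.seq n * M.seq N))) := by
        gcongr
    _ = _ := by ring

theorem integrable_weight :
    Integrable fun ξ : RSpace d => (1 + ‖ξ‖) ^ (-((d + 1 : ℕ) : ℝ)) :=
  integrable_one_add_norm (by simp)

theorem RapidDecay.integrable_pow_mul {τ : RSpace d → ℂ} (hτ : RapidDecay M τ)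
    (hm : AEStronglyMeasurable τ) (n : ℕ) : Integrable fun ξ => ‖ξ‖ ^ n * ‖τ ξ‖ := by
  obtain ⟨C, hC, H⟩ := hτ.exists_integrable_bound one_pos
  refine (integrable_weight.const_mul (C * (1 ^ n * M.seq n))).mono'
    ((by fun_prop : Continuous fun ξ : RSpace d => ‖ξ‖ ^ n).aestronglyMeasurable.mul hm.norm)
    (Filter.Eventually.of_forall fun ξ => ?_)
  rw [Real.norm_of_nonneg (by positivity)]
  exact H n ξ

theorem RapidDecay.integrable {τ : RSpace d → ℂ} (hτ : RapidDecay M τ)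
    (hm : AEStronglyMeasurable τ) : Integrable τ := by
  have := hτ.integrable_pow_mul hm 0
  simp only [pow_zero, one_mul] at this
  exact (integrable_norm_iff hm).1 this

/-- The Fourier transform of a rapidly decreasing function is ultradifferentiable. -/
theorem RapidDecay.fourier_mem_ultradiff {τ : RSpace d → ℂ} (hτ : RapidDecay M τ)
    (hm : AEStronglyMeasurable τ) : 𝓕 τ ∈ Ultradiff M Ω := by
  have hi : ∀ n : ℕ, ((n : ℕ∞) ≤ (⊤ : ℕ∞)) → Integrable fun ξ => ‖ξ‖ ^ n * ‖τ ξ‖ :=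
    fun n _ => hτ.integrable_pow_mul hm n
  rw [mem_ultradiff_iff]
  refine ⟨(Real.contDiff_fourier hi).contDiffOn, fun K _ _ h hh => ?_⟩
  set W : ℝ := ∫ ξ : RSpace d, (1 + ‖ξ‖) ^ (-((d + 1 : ℕ) : ℝ))
  have hW : 0 ≤ W := integral_nonneg fun ξ => by positivity
  set a : ℝ := 2 * Real.pi * ‖innerSL ℝ (E := RSpace d)‖ + 1
  have ha : 0 < a := by positivity
  obtain ⟨C, hC, H⟩ := hτ.exists_integrable_bound (div_pos hh ha)
  refine ⟨C * W, by positivity, fun x _ n => ?_⟩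
  rw [Real.iteratedFDeriv_fourier hi hm le_top]
  refine (VectorFourier.norm_fourierIntegral_le_integral_norm _ _ _ _ _).trans ?_
  have hbd : ∀ ξ : RSpace d, ‖VectorFourier.fourierPowSMulRight (innerSL ℝ) τ ξ n‖ ≤
      a ^ n * (C * ((h / a) ^ n * M.seq n)) * (1 + ‖ξ‖) ^ (-((d + 1 : ℕ) : ℝ)) := by
    intro ξ
    refine (VectorFourier.norm_fourierPowSMulRight_le _ _ _ _).trans ?_
    rw [mul_assoc, mul_assoc (a ^ n)]
    have h1 := H n ξ
    gcongr
    simp [a]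
  refine (integral_mono_of_nonneg (Filter.Eventually.of_forall fun _ => norm_nonneg _)
    (integrable_weight.const_mul _) (Filter.Eventually.of_forall hbd)).trans (le_of_eq ?_)
  rw [integral_const_mul]
  calc a ^ n * (C * ((h / a) ^ n * M.seq n)) * W = C * W * ((h / a * a) ^ n * M.seq n) := by
        rw [mul_pow]; ring
    _ = _ := by rw [div_mul_cancel₀ _ ha.ne']

/-- Decay of the Fourier transform of a test function. -/
theorem GaugeLE.pow_mul_norm_fourier_le {ψ : RSpace d → ℂ} (hψ : ContDiff ℝ ∞ ψ) (hK : IsCompact K)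
    (hsupp : tsupport ψ ⊆ K) {h B : ℝ} (hB : GaugeLE M h B ψ) (ξ : RSpace d) (n : ℕ) :
    ‖ξ‖ ^ n * ‖𝓕 ψ ξ‖ ≤ volume.real K * B * (h ^ n * M.seq n) := by
  have hcs : HasCompactSupport ψ := hK.of_isClosed_subset (isClosed_tsupport _) hsupp
  have hint : ∀ m : ℕ, ((m : ℕ∞) ≤ (⊤ : ℕ∞)) → Integrable (iteratedFDeriv ℝ m ψ) := fun m _ =>
    (hψ.continuous_iteratedFDeriv (by exact_mod_cast le_top)).integrable_of_hasCompactSupport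
      (hcs.iteratedFDeriv m)
  have h1 : ‖𝓕 (iteratedFDeriv ℝ n ψ) ξ‖ ≤ volume.real K * B * (h ^ n * M.seq n) := by
    refine (VectorFourier.norm_fourierIntegral_le_integral_norm _ _ _ _ _).trans ?_
    have e : ∫ x, ‖iteratedFDeriv ℝ n ψ x‖ = ∫ x in K, ‖iteratedFDeriv ℝ n ψ x‖ := by
      refine (setIntegral_eq_integral_of_forall_compl_eq_zero fun x hx => ?_).symm
      rw [iteratedFDeriv_eq_zero_of_notMem_tsupport fun h => hx (hsupp h), norm_zero]
    rw [e]
    have h2 := norm_setIntegral_le_of_norm_le_const (μ := volume) (s := K)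
      (f := fun x => ‖iteratedFDeriv ℝ n ψ x‖) hK.measure_lt_top
      (C := B * (h ^ n * M.seq n)) fun x _ => by rw [norm_norm]; exact hB x n
    exact ((le_abs_self _).trans h2).trans (le_of_eq (by ring))
  rw [Real.fourier_iteratedFDeriv hψ hint le_top] at h1
  have h2 := (VectorFourier.fourierPowSMulRight (-innerSL ℝ) (𝓕 ψ) ξ n).le_opNorm fun _ => ξ
  rw [VectorFourier.fourierPowSMulRight_apply, norm_smul, norm_smul, norm_pow, norm_prod] at h2
  have hin : ‖(-innerSL ℝ : RSpace d →L[ℝ] RSpace d →L[ℝ] ℝ) ξ ξ‖ = ‖ξ‖ ^ 2 := by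
    rw [neg_apply, neg_apply, norm_neg]
    simp
  rw [Finset.prod_const, Finset.prod_const, Finset.card_univ, Fintype.card_fin, hin] at h2
  simp only [norm_neg, norm_mul, Complex.norm_I, mul_one, Complex.norm_real, Real.norm_eq_abs,
    abs_of_pos Real.pi_pos, Complex.norm_ofNat] at h2
  set P := ‖VectorFourier.fourierPowSMulRight (-innerSL ℝ) (𝓕 ψ) ξ n‖
  have h3 : ‖ξ‖ ^ n * ‖𝓕 ψ ξ‖ * ‖ξ‖ ^ n ≤ P * ‖ξ‖ ^ n := by
    have hpi : 1 ≤ (2 * Real.pi) ^ n := one_le_pow₀ (by linarith [Real.pi_gt_three])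
    calc ‖ξ‖ ^ n * ‖𝓕 ψ ξ‖ * ‖ξ‖ ^ n = 1 * ((‖ξ‖ ^ 2) ^ n * ‖𝓕 ψ ξ‖) := by
          rw [← pow_mul, two_mul, pow_add]; ring
      _ ≤ (2 * Real.pi) ^ n * ((‖ξ‖ ^ 2) ^ n * ‖𝓕 ψ ξ‖) := by gcongr
      _ ≤ P * ‖ξ‖ ^ n := h2
  refine le_trans ?_ h1
  rcases (pow_nonneg (norm_nonneg ξ) n).eq_or_lt with h0 | h0
  · rw [← h0, zero_mul]; exact norm_nonneg _
  · exact le_of_mul_le_mul_right h3 h0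

theorem rapidDecay_fourier {φ : RSpace d → ℂ} (hφ : φ ∈ UltraTest M Ω) : RapidDecay M (𝓕 φ) := by
  intro h hh
  obtain ⟨B, hB, H⟩ := exists_gaugeLE hφ hh
  exact ⟨_, by positivity, fun n ξ =>
    H.pow_mul_norm_fourier_le (contDiff_of_mem_ultraTest hφ) hφ.2.1 le_rfl ξ n⟩

theorem integrable_of_mem_ultraTest {φ : RSpace d → ℂ} (hφ : φ ∈ UltraTest M Ω) : Integrable φ :=
  (contDiff_of_mem_ultraTest hφ).continuous.integrable_of_hasCompactSupport hφ.2.1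

theorem continuous_fourier {f : RSpace d → ℂ} (hf : Integrable f) : Continuous (𝓕 f) :=
  VectorFourier.fourierIntegral_continuous Real.continuous_fourierChar continuous_inner hf

theorem integral_fourier_mul {f g : RSpace d → ℂ} (hf : Integrable f) (hg : Integrable g) :
    ∫ ξ, 𝓕 f ξ * g ξ = ∫ x, f x * 𝓕 g x := by
  simpa using! VectorFourier.integral_fourierIntegral_smul_eq_flip (L := innerₗ (RSpace d))
    Real.continuous_fourierChar continuous_inner hf hg

theorem integrable_fourier {φ : RSpace d → ℂ} (hφ : φ ∈ UltraTest M Ω) : Integrable (𝓕 φ) :=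
  (rapidDecay_fourier hφ).integrable
    (continuous_fourier (integrable_of_mem_ultraTest hφ)).aestronglyMeasurable

/-- Fourier inversion for test functions. -/
theorem fourier_fourier_neg {φ : RSpace d → ℂ} (hφ : φ ∈ UltraTest M Ω) :
    𝓕 (fun ξ => 𝓕 φ (-ξ)) = φ := by
  rw [← Real.fourierInv_eq_fourier_comp_neg]
  exact (contDiff_of_mem_ultraTest hφ).continuous.fourierInv_fourier_eq
    (integrable_of_mem_ultraTest hφ) (integrable_fourier hφ)

end FourierDecay

/-! ### Decay from approximation -/

section Transform

open scoped FourierTransform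

variable {d : ℕ} {M : WeightSequence} {Ω : TopologicalSpace.Opens (RSpace d)}
  {K : Set (RSpace d)}

/-- The trade-off behind the theorem. A function `τ` is approximated by `v ε` up to
`e^{M(κ₁|ξ|) - M(b/ε)}`, while `v ε` decays rapidly with constants `O(e^{M(k/ε)})`, `k` being
independent of the rate of decay. Choosing `ε` proportional to `1 / |ξ|` makes both contributions
small. -/
theorem rapidDecay_of_approximation {τ : RSpace d → ℂ} {v : NetIndex → RSpace d → ℂ}
    {κ₁ b k C₂ C₃ : ℝ} {ε₀ : NetIndex} (hκ₁ : 0 < κ₁) (hb : 0 < b) (hk : 0 < k) (hC₂ : 0 ≤ C₂)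
    (hC₃ : 0 ≤ C₃) (h2 : ∀ ξ, ‖τ ξ‖ ≤ C₂ * M.expAssoc (κ₁ * ‖ξ‖))
    (h3 : ∀ ε < ε₀, ∀ ξ, M.expAssoc (b / ε) * ‖v ε ξ - τ ξ‖ ≤ C₃ * M.expAssoc (κ₁ * ‖ξ‖))
    (h4 : ∀ h : ℝ, 0 < h → ∃ C : ℝ, 0 ≤ C ∧ ∃ ε₁ : NetIndex, ∀ ε < ε₁, ∀ (ξ : RSpace d) (n : ℕ),
      ‖ξ‖ ^ n * ‖v ε ξ‖ ≤ C * M.expAssoc (k / ε) * (h ^ n * M.seq n)) :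
    RapidDecay M τ := by
  obtain ⟨c, H, hc, hH, hM2⟩ := M.exists_seq_add_le
  obtain ⟨c', H', hc', hH', hsq⟩ := M.exists_expAssoc_sq_le
  have hH0 : 0 < H := by linarith
  have hH'0 : 0 < H' := by linarith
  intro h hh
  set σ : ℝ := max κ₁ h⁻¹ with hσ
  have hσ0 : 0 < σ := hκ₁.trans_le (le_max_left _ _)
  -- `ε` will be chosen with `b / ε = L |ξ|`, and then `k / ε = κ |ξ|`
  set L : ℝ := H' * σ with hL
  have hL0 : 0 < L := by positivity
  set κ : ℝ := k * L / b with hκ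
  have hκ0 : 0 < κ := by positivity
  set η : ℝ := min h κ⁻¹ with hη
  have hη0 : 0 < η := lt_min hh (by positivity)
  obtain ⟨C₄, hC₄, ε₁, h4'⟩ := h4 (η / H) (by positivity)
  have hm0 : 0 < min (ε₀ : ℝ) ε₁ := lt_min ε₀.2.1 ε₁.2.1
  set R : ℝ := b / (L * min (ε₀ : ℝ) ε₁) with hR
  have hR0 : 0 < R := by positivity
  have hE := M.expAssoc_pos
  refine ⟨C₂ * M.expAssoc (κ₁ * R) * M.expAssoc (R / h) + (C₃ * c' + c * C₄), by
    have := hE (κ₁ * R); have := hE (R / h); positivity, fun n ξ => ?_⟩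
  set ρ := ‖ξ‖ with hρdef
  have hρ : 0 ≤ ρ := norm_nonneg ξ
  have hMn := M.pos n
  have hgn := M.gauge_pos hh n
  rcases le_or_gt ρ R with hle | hgt
  · have e1 : ρ ^ n ≤ M.expAssoc (R / h) * (h ^ n * M.seq n) := by
      have := M.pow_le_expAssoc (ρ := R / h) (by positivity) n
      rw [div_pow, div_le_iff₀ (by positivity)] at this
      calc ρ ^ n ≤ R ^ n := by gcongr
        _ ≤ _ := this
        _ = _ := by ring
    have e2 : ‖τ ξ‖ ≤ C₂ * M.expAssoc (κ₁ * R) := (h2 ξ).trans (by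
      gcongr
      exact M.expAssoc_mono (by positivity) (by gcongr))
    have h0 := hE (R / h)
    calc ρ ^ n * ‖τ ξ‖ ≤ (M.expAssoc (R / h) * (h ^ n * M.seq n)) * (C₂ * M.expAssoc (κ₁ * R)) := by
          gcongr
      _ = C₂ * M.expAssoc (κ₁ * R) * M.expAssoc (R / h) * (h ^ n * M.seq n) := by ring
      _ ≤ _ := by
          gcongr
          exact le_add_of_nonneg_right (by positivity)
  · have hρ0 : 0 < ρ := hR0.trans hgt
    have hεlt : b / (L * ρ) < min (ε₀ : ℝ) ε₁ := by
      rw [div_lt_iff₀ (by positivity)]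
      rw [hR, div_lt_iff₀ (by positivity)] at hgt
      linarith
    let ε : NetIndex := ⟨b / (L * ρ), by positivity,
      hεlt.trans ((min_le_left _ _).trans_lt ε₀.2.2)⟩
    have hε0 : ε < ε₀ := Subtype.coe_lt_coe.1 (hεlt.trans_le (min_le_left _ _))
    have hε1 : ε < ε₁ := Subtype.coe_lt_coe.1 (hεlt.trans_le (min_le_right _ _))
    have hbε : b / (ε : ℝ) = H' * (σ * ρ) := by
      change b / (b / (L * ρ)) = _
      rw [hL]; field_simp
    have hkε : k / (ε : ℝ) = κ * ρ := by
      change k / (b / (L * ρ)) = _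
      rw [hκ]; field_simp
    have hσρ : 0 < σ * ρ := by positivity
    have e1 : ρ ^ n * ‖v ε ξ - τ ξ‖ ≤ C₃ * c' * (h ^ n * M.seq n) := by
      have a1 := h3 ε hε0 ξ
      rw [hbε] at a1
      have a2 : M.expAssoc (κ₁ * ρ) ≤ M.expAssoc (σ * ρ) :=
        M.expAssoc_mono (by positivity) (by gcongr; exact le_max_left _ _)
      have a3 : ρ ^ n ≤ h ^ n * M.seq n * M.expAssoc (σ * ρ) := by
        have a5 := M.pow_le_expAssoc hσρ.le n
        have a6 : ρ ≤ h * (σ * ρ) := by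
          have : 1 ≤ h * σ := by
            rw [← mul_inv_cancel₀ hh.ne']
            gcongr
            exact le_max_right _ _
          nlinarith
        calc ρ ^ n ≤ (h * (σ * ρ)) ^ n := by gcongr
          _ = h ^ n * (σ * ρ) ^ n := mul_pow _ _ _
          _ ≤ h ^ n * (M.seq n * M.expAssoc (σ * ρ)) := by gcongr
          _ = _ := by ring
      have a4 := hsq _ hσρ
      have h0 := hE (σ * ρ)
      have h0' := hE (H' * (σ * ρ))
      refine le_of_mul_le_mul_right ?_ h0'
      calc ρ ^ n * ‖v ε ξ - τ ξ‖ * M.expAssoc (H' * (σ * ρ))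
          = ρ ^ n * (M.expAssoc (H' * (σ * ρ)) * ‖v ε ξ - τ ξ‖) := by ring
        _ ≤ (h ^ n * M.seq n * M.expAssoc (σ * ρ)) * (C₃ * M.expAssoc (κ₁ * ρ)) := by
            gcongr
        _ ≤ (h ^ n * M.seq n * M.expAssoc (σ * ρ)) * (C₃ * M.expAssoc (σ * ρ)) := by gcongr
        _ = C₃ * (h ^ n * M.seq n) * (M.expAssoc (σ * ρ) * M.expAssoc (σ * ρ)) := by ring
        _ ≤ C₃ * (h ^ n * M.seq n) * (c' * M.expAssoc (H' * (σ * ρ))) := by gcongr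
        _ = _ := by ring
    have e2 : ρ ^ n * ‖v ε ξ‖ ≤ c * C₄ * (h ^ n * M.seq n) := by
      have a1 := M.pow_mul_expAssoc_le hH hM2 (by positivity) hρ (norm_nonneg (v ε ξ))
        (fun m => h4' ε hε1 ξ m) n
      rw [div_mul_cancel₀ _ hH0.ne', hkε] at a1
      have a2 : M.expAssoc (κ * ρ) ≤ M.expAssoc (ρ / η) := by
        refine M.expAssoc_mono (by positivity) ?_
        rw [div_eq_inv_mul]
        gcongr
        rw [le_inv_comm₀ hκ0 hη0]
        exact min_le_right _ _
      have a3 : η ^ n ≤ h ^ n := by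
        gcongr
        exact min_le_left _ _
      have h0 := hE (ρ / η)
      refine le_of_mul_le_mul_right (a1.trans ?_) h0
      calc c * (C₄ * M.expAssoc (κ * ρ)) * (η ^ n * M.seq n)
          ≤ c * (C₄ * M.expAssoc (ρ / η)) * (h ^ n * M.seq n) := by gcongr
        _ = _ := by ring
    have e3 : ‖τ ξ‖ ≤ ‖v ε ξ - τ ξ‖ + ‖v ε ξ‖ := by
      have := norm_sub_le (v ε ξ) (v ε ξ - τ ξ)
      rw [sub_sub_cancel] at this
      linarith
    have h5 := hE (κ₁ * R)
    have h6 := hE (R / h)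
    calc ρ ^ n * ‖τ ξ‖ ≤ ρ ^ n * (‖v ε ξ - τ ξ‖ + ‖v ε ξ‖) := by gcongr
      _ ≤ C₃ * c' * (h ^ n * M.seq n) + c * C₄ * (h ^ n * M.seq n) := by rw [mul_add]; gcongr
      _ = (C₃ * c' + c * C₄) * (h ^ n * M.seq n) := by ring
      _ ≤ _ := mul_le_mul_of_nonneg_right (le_add_of_nonneg_left (by positivity)) hgn.le

/-- The test function `x ↦ e^{-2πi⟨x, ξ⟩} χ(x)`. -/
def waveTest (χ : UltraTest M Ω) (ξ : RSpace d) : UltraTest M Ω :=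
  ⟨wave ξ * (χ : RSpace d → ℂ), mul_mem_ultraTest (wave_mem_ultradiff ξ) χ.2⟩

theorem tsupport_waveTest_subset (χ : UltraTest M Ω) (ξ : RSpace d) :
    tsupport (waveTest χ ξ : RSpace d → ℂ) ⊆ tsupport (χ : RSpace d → ℂ) :=
  (tsupport_mul_subset_right : tsupport (wave ξ * (χ : RSpace d → ℂ)) ⊆ _)

theorem exists_gaugeLE_waveTest (χ : UltraTest M Ω) {h : ℝ} (hh : 0 < h) :
    ∃ A : ℝ, 0 ≤ A ∧ ∀ ξ : RSpace d,
      GaugeLE M h (A * M.expAssoc (4 * Real.pi / h * ‖ξ‖)) (waveTest χ ξ : RSpace d → ℂ) := by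
  obtain ⟨A, hA, H⟩ := exists_gaugeLE χ.2 (half_pos hh)
  refine ⟨A, hA, fun ξ x n => ?_⟩
  have := norm_iteratedFDeriv_mul_le_gauge (Ω := ⊤) (contDiff_wave ξ).contDiffOn
    (contDiff_of_mem_ultraTest χ.2).contDiffOn (Set.mem_univ x) (half_pos hh)
    (M.expAssoc_pos _).le (norm_iteratedFDeriv_wave_le_gauge (half_pos hh) ξ x) (H x) n
  rw [mul_div_cancel₀ _ two_ne_zero] at this
  refine this.trans (le_of_eq ?_)
  have e : 2 * Real.pi * ‖ξ‖ / (h / 2) = 4 * Real.pi / h * ‖ξ‖ := by field_simp; ring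
  rw [e]; ring

theorem pairing_waveTest (f : RSpace d → ℂ) (χ : UltraTest M Ω) (ξ : RSpace d) :
    pairing f (waveTest χ ξ) = 𝓕 (f * (χ : RSpace d → ℂ)) ξ := by
  rw [pairing_eq_integral, Real.fourier_eq]
  congr 1
  funext x
  simp only [waveTest, wave, Pi.mul_apply, Circle.smul_def, smul_eq_mul]
  ring

/-- Gauge bounds for a product `f χ`, where `f` is bounded on the support of `χ`. -/
theorem gaugeLE_mul_of_unorm_le {f : RSpace d → ℂ} (hf : f ∈ Ultradiff M Ω) (χ : UltraTest M Ω)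
    {h A B : ℝ} (hh : 0 < h) (hA : 0 ≤ A) (hB : 0 ≤ B)
    (hu : unorm M (tsupport (χ : RSpace d → ℂ)) (h / (2 * (d + 1))) f ≤ ENNReal.ofReal A)
    (hχ : GaugeLE M (h / 2) B (χ : RSpace d → ℂ)) :
    GaugeLE M h (A * B) (f * (χ : RSpace d → ℂ)) := by
  have hd : (0 : ℝ) < d + 1 := by positivity
  refine gaugeLE_of_tsupport_subset tsupport_mul_subset_right hh (by positivity)
    fun x hx n => ?_
  have h1 : ∀ n : ℕ, ‖iteratedFDeriv ℝ n f x‖ ≤ A * ((h / 2) ^ n * M.seq n) := by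
    intro n
    have := norm_iteratedFDeriv_le_of_unorm_le χ.2.2.2 hf.1 (by positivity) hA hu hx n
    have e : ((d : ℝ) + 1) * (h / (2 * (d + 1))) = h / 2 := by field_simp
    rwa [e] at this
  have := norm_iteratedFDeriv_mul_le_gauge hf.1 (contDiff_of_mem_ultraTest χ.2).contDiffOn
    (χ.2.2.2 hx) (half_pos hh) hA h1 (hχ x) n
  rwa [mul_div_cancel₀ _ two_ne_zero] at this

end Transform

/-! ### Local representation, gluing and the theorem -/

section Representation

open scoped FourierTransform

variable {d : ℕ} {M : WeightSequence} {Ω : TopologicalSpace.Opens (RSpace d)}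
  {K : Set (RSpace d)}

theorem exists_seq_netIndex : ∃ ε : ℕ → NetIndex,
    Filter.Tendsto (fun n => (ε n : ℝ)) Filter.atTop (𝓝 0) := by
  refine ⟨fun n => ⟨((n : ℝ) + 2)⁻¹, by positivity,
    inv_lt_one_of_one_lt₀ (by linarith [(Nat.cast_nonneg n : (0 : ℝ) ≤ n)])⟩, ?_⟩
  exact tendsto_inv_atTop_zero.comp
    (Filter.tendsto_atTop_add_const_right _ _ tendsto_natCast_atTop_atTop)

theorem tendsto_inv_expAssoc {b : ℝ} (hb : 0 < b) {ε : ℕ → NetIndex}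
    (hε : Filter.Tendsto (fun n => (ε n : ℝ)) Filter.atTop (𝓝 0)) :
    Filter.Tendsto (fun n => (M.expAssoc (b / ε n))⁻¹) Filter.atTop (𝓝 0) := by
  have h1 : Filter.Tendsto (fun n => (M.seq 1 / b) * (ε n : ℝ)) Filter.atTop (𝓝 0) := by
    simpa using hε.const_mul (M.seq 1 / b)
  refine squeeze_zero (fun n => (inv_pos.2 (M.expAssoc_pos _)).le) (fun n => ?_) h1
  have h0 : 0 < (ε n : ℝ) := (ε n).2.1
  have hM := M.pos 1
  have := M.div_le_expAssoc (div_pos hb h0).le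
  rw [inv_le_iff_one_le_mul₀ (M.expAssoc_pos _)]
  calc (1 : ℝ) = M.seq 1 / b * (ε n : ℝ) * (b / (ε n : ℝ) / M.seq 1) := by field_simp
    _ ≤ _ := by gcongr

/-- A linear form with a regular, strongly associated net is represented near each compact set by
an ultradifferentiable function. It is the Fourier transform of `ξ ↦ ⟨T, e_{-ξ} χ⟩` for a cutoff
function `χ`. -/
theorem exists_local_representation {v : NetIndex → RSpace d → ℂ} (hv : ∀ ε, v ε ∈ Ultradiff M Ω)
    (hreg : ∀ K : Set (RSpace d), IsCompact K → K ⊆ Ω → ∃ k : ℝ, 0 < k ∧ ∀ h : ℝ, 0 < h →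
      NetBigO (fun ε => unorm M K h (v ε)) fun ε => Real.exp (M.assoc (k / ε)))
    {T : UltraTest M Ω →ₗ[ℂ] ℂ} (hT : IsUltradistribution T)
    (hassoc : ∀ K : Set (RSpace d), IsCompact K → K ⊆ Ω → ∃ b : ℝ, 0 < b ∧
      ∀ φ : UltraTest M Ω, tsupport (φ : RSpace d → ℂ) ⊆ K →
        NetBigO (fun ε => ‖pairing (v ε) φ - T φ‖ₑ) fun ε => Real.exp (-M.assoc (b / ε)))
    (hK : IsCompact K) (hKΩ : K ⊆ Ω) :
    ∃ f ∈ Ultradiff M Ω, ∀ φ : UltraTest M Ω, tsupport (φ : RSpace d → ℂ) ⊆ K →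
      T φ = pairing f φ := by
  obtain ⟨χ₀, hχ₀, U, -, hKU, hχ1⟩ := exists_cutoff M Ω hK hKΩ
  let χ : UltraTest M Ω := ⟨χ₀, hχ₀⟩
  set S : Set (RSpace d) := tsupport (χ : RSpace d → ℂ) with hS
  have hSc : IsCompact S := χ.2.2.1
  have hSΩ : S ⊆ Ω := χ.2.2.2
  have hKS : K ⊆ S := fun x hx => subset_tsupport _ (by
    rw [Function.mem_support]
    change χ₀ x ≠ 0
    rw [hχ1 x (hKU hx)]
    exact one_ne_zero)
  obtain ⟨k, hk, hreg⟩ := hreg S hSc hSΩ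
  obtain ⟨b, hb, hassoc⟩ := hassoc S hSc hSΩ
  obtain ⟨h₀, hh₀, C₀, hC₀, ε₀, huni⟩ := exists_uniform_association hv hT hSc hSΩ hassoc
  obtain ⟨h₁, hh₁, C₁, hC₁, hTc⟩ := hT.continuousOnTest hSc hSΩ
  obtain ⟨A₀, hA₀, hw₀⟩ := exists_gaugeLE_waveTest χ hh₀
  obtain ⟨A₁, hA₁, hw₁⟩ := exists_gaugeLE_waveTest χ hh₁
  have hπ := Real.pi_pos
  set κ₁ : ℝ := max (4 * Real.pi / h₀) (4 * Real.pi / h₁) with hκ₁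
  have hκ₁0 : 0 < κ₁ := (by positivity : 0 < 4 * Real.pi / h₀).trans_le (le_max_left _ _)
  have hE := M.expAssoc_pos
  set τ : RSpace d → ℂ := fun ξ => T (waveTest χ ξ) with hτdef
  set V : NetIndex → RSpace d → ℂ := fun ε => 𝓕 (v ε * (χ : RSpace d → ℂ)) with hVdef
  have hVp : ∀ ε ξ, V ε ξ = pairing (v ε) (waveTest χ ξ) := fun ε ξ => (pairing_waveTest _ _ _).symm
  have h2 : ∀ ξ, ‖τ ξ‖ ≤ C₁ * A₁ * M.expAssoc (κ₁ * ‖ξ‖) := by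
    intro ξ
    refine (hTc _ (tsupport_waveTest_subset χ ξ) _
      (mul_nonneg hA₁ (hE _).le) (hw₁ ξ)).trans ?_
    rw [mul_assoc]
    gcongr
    refine M.expAssoc_mono (by positivity) ?_
    gcongr
    exact le_max_right _ _
  have h3 : ∀ ε < ε₀, ∀ ξ, M.expAssoc (b / ε) * ‖V ε ξ - τ ξ‖ ≤
      C₀ * A₀ * M.expAssoc (κ₁ * ‖ξ‖) := by
    intro ε hε ξ
    rw [hVp]
    refine (huni ε hε _ (tsupport_waveTest_subset χ ξ) _
      (mul_nonneg hA₀ (hE _).le) (hw₀ ξ)).trans ?_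
    rw [mul_assoc]
    gcongr
    refine M.expAssoc_mono (by positivity) ?_
    gcongr
    exact le_max_left _ _
  have hvχ : ∀ ε, v ε * (χ : RSpace d → ℂ) ∈ UltraTest M Ω := fun ε => mul_mem_ultraTest (hv ε) χ.2
  have h4 : ∀ h : ℝ, 0 < h → ∃ C : ℝ, 0 ≤ C ∧ ∃ ε₁ : NetIndex, ∀ ε < ε₁,
      ∀ (ξ : RSpace d) (n : ℕ),
        ‖ξ‖ ^ n * ‖V ε ξ‖ ≤ C * M.expAssoc (k / ε) * (h ^ n * M.seq n) := by
    intro h hh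
    obtain ⟨B, hB, hχB⟩ := exists_gaugeLE χ.2 (half_pos hh)
    obtain ⟨C, hC, ε₁, H⟩ := hreg (h / (2 * (d + 1))) (by positivity)
    refine ⟨volume.real S * (C * B), by positivity, ε₁, fun ε hε ξ n => ?_⟩
    have hA : 0 ≤ C * M.expAssoc (k / ε) := mul_nonneg hC (hE _).le
    have := (gaugeLE_mul_of_unorm_le (hv ε) χ hh hA hB (H ε hε) hχB).pow_mul_norm_fourier_le
      (contDiff_of_mem_ultraTest (hvχ ε)) hSc tsupport_mul_subset_right ξ n
    exact this.trans (le_of_eq (by ring))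
  have hτ : RapidDecay M τ := rapidDecay_of_approximation hκ₁0 hb hk (mul_nonneg hC₁ hA₁)
    (mul_nonneg hC₀ hA₀) h2 h3 h4
  -- along a sequence `ε_n → 0` the transforms of `v_ε χ` converge pointwise to `τ`
  obtain ⟨ε, hε⟩ := exists_seq_netIndex
  have hεev : ∀ᶠ n in Filter.atTop, ε n < ε₀ :=
    (hε.eventually (gt_mem_nhds ε₀.2.1)).mono fun n hn => Subtype.coe_lt_coe.1 hn
  have hlim : ∀ {a : ℕ → ℂ} {l : ℂ} {C : ℝ},
      (∀ᶠ n in Filter.atTop, M.expAssoc (b / ε n) * ‖a n - l‖ ≤ C) →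
        Filter.Tendsto a Filter.atTop (𝓝 l) := by
    intro a l C h
    rw [tendsto_iff_norm_sub_tendsto_zero]
    refine squeeze_zero' (Filter.Eventually.of_forall fun _ => norm_nonneg _)
      (h.mono fun n hn => ?_) (by simpa using (tendsto_inv_expAssoc (M := M) hb hε).const_mul C)
    rw [← div_eq_mul_inv, le_div_iff₀ (hE _), mul_comm]
    exact hn
  have hVlim : ∀ ξ, Filter.Tendsto (fun n => V (ε n) ξ) Filter.atTop (𝓝 (τ ξ)) := fun ξ =>
    hlim (hεev.mono fun n hn => h3 _ hn ξ)
  have hVc : ∀ ε, Continuous (V ε) := fun ε => continuous_fourier (integrable_of_mem_ultraTest (hvχ ε))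
  have hτm : AEStronglyMeasurable τ :=
    aestronglyMeasurable_of_tendsto_ae Filter.atTop (fun n => (hVc (ε n)).aestronglyMeasurable)
      (Filter.Eventually.of_forall hVlim)
  have hτneg : AEStronglyMeasurable fun ξ => τ (-ξ) :=
    hτm.comp_quasiMeasurePreserving (Measure.measurePreserving_neg _).quasiMeasurePreserving
  refine ⟨𝓕 fun ξ => τ (-ξ), hτ.comp_neg.fourier_mem_ultradiff hτneg, fun φ hφ => ?_⟩
  set θ : RSpace d → ℂ := fun ξ => 𝓕 (φ : RSpace d → ℂ) (-ξ) with hθdef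
  have hθ : RapidDecay M θ := (rapidDecay_fourier φ.2).comp_neg
  have hφc := continuous_fourier (integrable_of_mem_ultraTest φ.2)
  have hθc : Continuous θ := hφc.comp continuous_neg
  have hθi : Integrable θ := hθ.integrable hθc.aestronglyMeasurable
  have hpair : ∀ n, pairing (v (ε n)) φ = ∫ ξ, V (ε n) ξ * θ ξ := by
    intro n
    rw [hVdef, integral_fourier_mul (integrable_of_mem_ultraTest (hvχ _)) hθi,
      fourier_fourier_neg φ.2, pairing_eq_integral]
    congr 1
    funext x
    by_cases hx : (φ : RSpace d → ℂ) x = 0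
    · simp [hx]
    · have hx1 : (χ : RSpace d → ℂ) x = 1 := hχ1 x (hKU (hφ (subset_tsupport _ hx)))
      rw [Pi.mul_apply, hx1, mul_one]
  have hleft : Filter.Tendsto (fun n => pairing (v (ε n)) φ) Filter.atTop (𝓝 (T φ)) := by
    obtain ⟨B, hB, hφB⟩ := exists_gaugeLE φ.2 hh₀
    exact hlim (hεev.mono fun n hn => huni _ hn φ (hφ.trans hKS) B hB hφB)
  have hright : Filter.Tendsto (fun n => ∫ ξ, V (ε n) ξ * θ ξ) Filter.atTop
      (𝓝 (∫ ξ, τ ξ * θ ξ)) := by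
    obtain ⟨C, hC, HC⟩ := (hθ.expAssoc_mul hκ₁0.le).exists_integrable_bound one_pos
    refine tendsto_integral_filter_of_dominated_convergence
      (fun ξ => (C₁ * A₁ + C₀ * A₀) * (C * (1 ^ 0 * M.seq 0) * (1 + ‖ξ‖) ^ (-((d + 1 : ℕ) : ℝ))))
      (Filter.Eventually.of_forall fun n => ((hVc _).mul hθc).aestronglyMeasurable)
      (hεev.mono fun n hn => Filter.Eventually.of_forall fun ξ => ?_)
      ((integrable_weight.const_mul _).const_mul _)
      (Filter.Eventually.of_forall fun ξ => (hVlim ξ).mul_const _)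
    have a1 : ‖V (ε n) ξ - τ ξ‖ ≤ C₀ * A₀ * M.expAssoc (κ₁ * ‖ξ‖) :=
      (le_mul_of_one_le_left (norm_nonneg _) (M.one_le_expAssoc _)).trans (h3 _ hn ξ)
    have a2 : ‖V (ε n) ξ‖ ≤ (C₁ * A₁ + C₀ * A₀) * M.expAssoc (κ₁ * ‖ξ‖) := by
      have := norm_add_le (V (ε n) ξ - τ ξ) (τ ξ)
      rw [sub_add_cancel] at this
      linarith [h2 ξ]
    have a3 := HC 0 ξ
    rw [pow_zero, one_mul, norm_mul, Complex.norm_real, Real.norm_eq_abs, abs_of_pos (hE _)] at a3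
    rw [norm_mul]
    calc ‖V (ε n) ξ‖ * ‖θ ξ‖ ≤ (C₁ * A₁ + C₀ * A₀) * M.expAssoc (κ₁ * ‖ξ‖) * ‖θ ξ‖ := by gcongr
      _ = (C₁ * A₁ + C₀ * A₀) * (M.expAssoc (κ₁ * ‖ξ‖) * ‖θ ξ‖) := by ring
      _ ≤ _ := by gcongr
  rw [tendsto_nhds_unique hleft (hright.congr fun n => (hpair n).symm), pairing_eq_integral,
    integral_fourier_mul (hτ.comp_neg.integrable hτneg) (integrable_of_mem_ultraTest φ.2),
    ← integral_neg_eq_self]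
  simp only [hθdef, neg_neg]

/-- Ultradifferentiable test functions separate continuous functions. -/
theorem eqOn_of_pairing_eq {f g : RSpace d → ℂ} {U : Set (RSpace d)} (hU : IsOpen U) (hUΩ : U ⊆ Ω)
    (hf : f ∈ Ultradiff M Ω) (hg : g ∈ Ultradiff M Ω)
    (H : ∀ φ : UltraTest M Ω, tsupport (φ : RSpace d → ℂ) ⊆ U → pairing f φ = pairing g φ) :
    Set.EqOn f g U := by
  intro z hz
  by_contra hne
  set w : RSpace d → ℂ := f - g with hw
  have hwm : w ∈ Ultradiff M Ω := sub_mem hf hg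
  have hwz : 0 < ‖w z‖ := norm_pos_iff.2 (sub_ne_zero.2 hne)
  have hwc : ContinuousAt w z :=
    (hwm.1.contDiffAt (Ω.isOpen.mem_nhds (hUΩ hz))).continuousAt
  obtain ⟨χ, hχ, h01, hsub, h1⟩ := exists_bump M Ω (x₀ := z)
    (U := U ∩ {x | ‖w x - w z‖ < ‖w z‖ / 2})
    (Filter.inter_mem (hU.mem_nhds hz) (by
      have := Metric.tendsto_nhds.1 hwc (‖w z‖ / 2) (half_pos hwz)
      simp only [dist_eq_norm] at this
      exact this))
    (Set.inter_subset_left.trans hUΩ)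
  set φ : UltraTest M Ω := ⟨_, hχ⟩
  have hχi : Integrable χ := by
    have := (integrable_of_mem_ultraTest hχ).re
    simpa using this
  have hχc : Continuous χ := by
    have := Complex.continuous_re.comp (contDiff_of_mem_ultraTest hχ).continuous
    simpa [Function.comp_def] using this
  have hpos : 0 < ∫ x, χ x :=
    hχc.integral_pos_of_hasCompactSupport_nonneg_nonzero (x := z)
      (by
        have := hχ.2.1.comp_left (g := Complex.re) Complex.zero_re
        simpa [Function.comp_def] using this)
      (fun x => (h01 x).1) (by rw [h1.self_of_nhds]; exact one_ne_zero)
  have hzero : ∫ x, w x * (χ x : ℂ) = 0 := by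
    have := H φ (hsub.trans Set.inter_subset_left)
    rw [← sub_eq_zero, ← pairing_sub hf hg, pairing_eq_integral] at this
    exact this
  have hdiff : ∫ x, (w x - w z) * (χ x : ℂ) = -(w z * ((∫ x, χ x : ℝ) : ℂ)) := by
    have hi : Integrable fun x => w x * (χ x : ℂ) := integrable_mul hwm φ
    have hi' : Integrable fun x => w z * (χ x : ℂ) := (integrable_of_mem_ultraTest hχ).const_mul _
    simp only [sub_mul]
    rw [integral_sub hi hi', hzero, zero_sub,
      integral_const_mul, integral_complex_ofReal]
  have hle : ‖∫ x, (w x - w z) * (χ x : ℂ)‖ ≤ ‖w z‖ / 2 * ∫ x, χ x := by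
    rw [← integral_const_mul]
    refine norm_integral_le_of_norm_le (hχi.const_mul _) (Filter.Eventually.of_forall fun x => ?_)
    rw [norm_mul, Complex.norm_real, Real.norm_of_nonneg (h01 x).1]
    by_cases hx : χ x = 0
    · simp [hx]
    · have : x ∈ tsupport fun x => (χ x : ℂ) := subset_tsupport _ (by simpa using hx)
      exact mul_le_mul_of_nonneg_right (hsub this).2.le (h01 x).1
  rw [hdiff, norm_neg, norm_mul, Complex.norm_real, Real.norm_of_nonneg hpos.le] at hle
  nlinarith

/-- Local representatives on compact sets glue to a global one. -/
theorem exists_global_representation {T : UltraTest M Ω →ₗ[ℂ] ℂ}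
    (H : ∀ K : Set (RSpace d), IsCompact K → K ⊆ Ω → ∃ f ∈ Ultradiff M Ω, ∀ φ : UltraTest M Ω,
      tsupport (φ : RSpace d → ℂ) ⊆ K → T φ = pairing f φ) :
    ∃ f ∈ Ultradiff M Ω, ∀ φ : UltraTest M Ω, T φ = pairing f φ := by
  choose! F hF hFT using H
  have hnb : ∀ x : RSpace d, x ∈ Ω → ∃ L : Set (RSpace d), IsCompact L ∧ x ∈ interior L ∧ L ⊆ Ω :=
    fun x hx => exists_compact_subset Ω.isOpen hx
  choose! L hLc hxL hLΩ using hnb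
  set f : RSpace d → ℂ := fun x => F (L x) x with hf
  have heq : ∀ K : Set (RSpace d), IsCompact K → K ⊆ Ω → Set.EqOn f (F K) (interior K) := by
    intro K hK hKΩ x hx
    have hxΩ : x ∈ Ω := hKΩ (interior_subset hx)
    refine eqOn_of_pairing_eq (U := interior (L x) ∩ interior K)
      (isOpen_interior.inter isOpen_interior)
      (Set.inter_subset_right.trans (interior_subset.trans hKΩ)) (hF _ (hLc x hxΩ) (hLΩ x hxΩ))
      (hF _ hK hKΩ) (fun φ hφ => ?_) ⟨hxL x hxΩ, hx⟩
    rw [← hFT _ (hLc x hxΩ) (hLΩ x hxΩ) φ (hφ.trans (Set.inter_subset_left.trans interior_subset)),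
      ← hFT _ hK hKΩ φ (hφ.trans (Set.inter_subset_right.trans interior_subset))]
  have hloc : ∀ K : Set (RSpace d), IsCompact K → K ⊆ Ω → ∃ K' : Set (RSpace d), IsCompact K' ∧
      K ⊆ interior K' ∧ K' ⊆ Ω := fun K hK hKΩ => exists_compact_between hK Ω.isOpen hKΩ
  refine ⟨f, mem_ultradiff_of_locally fun K hK hKΩ => ?_, fun φ => ?_⟩
  · obtain ⟨K', hK', hKK', hK'Ω⟩ := hloc K hK hKΩ
    exact ⟨_, hF K' hK' hK'Ω, _, isOpen_interior, hKK', heq K' hK' hK'Ω⟩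
  · obtain ⟨K', hK', hKK', hK'Ω⟩ := hloc _ φ.2.2.1 φ.2.2.2
    rw [hFT K' hK' hK'Ω φ (hKK'.trans interior_subset), pairing_eq_integral, pairing_eq_integral]
    congr 1
    funext x
    by_cases hx : (φ : RSpace d → ℂ) x = 0
    · simp [hx]
    · rw [heq K' hK' hK'Ω (hKK' (subset_tsupport _ hx))]

/-- Strong association passes from one representative to another. -/
theorem association_of_negligible_sub {u v : NetIndex → RSpace d → ℂ}
    (hu : ∀ ε, u ε ∈ Ultradiff M Ω) (hv : ∀ ε, v ε ∈ Ultradiff M Ω)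
    (huv : v - u ∈ UltraNegligible M Ω) {T : UltraTest M Ω →ₗ[ℂ] ℂ} {b : ℝ} (hb : 0 ≤ b)
    (φ : UltraTest M Ω)
    (H : NetBigO (fun ε => ‖pairing (u ε) φ - T φ‖ₑ) fun ε => Real.exp (-M.assoc (b / ε))) :
    NetBigO (fun ε => ‖pairing (v ε) φ - T φ‖ₑ) fun ε => Real.exp (-M.assoc (b / ε)) := by
  have hneg : NetBigO (fun ε => ‖pairing (v ε - u ε) φ‖ₑ)
      fun ε => Real.exp (-M.assoc (b / ε)) := by
    obtain ⟨C, hC, ε₀, h⟩ := huv.2 _ φ.2.2.1 φ.2.2.2 1 one_pos b hb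
    obtain ⟨B, hB, hφB⟩ := exists_gaugeLE φ.2 one_pos
    refine ⟨C * B * volume.real (tsupport (φ : RSpace d → ℂ)), by positivity, ε₀, fun ε hε => ?_⟩
    have h0 : 0 ≤ C * Real.exp (-M.assoc (b / ε)) := mul_nonneg hC (Real.exp_pos _).le
    have h1 := norm_pairing_le (f := v ε - u ε) φ.2.2.1 le_rfl (fun x hx => by
      have := norm_iteratedFDeriv_le_of_unorm_le φ.2.2.2 (huv.1 ε).1 one_pos h0 (h ε hε) hx 0
      simpa [M.zero] using this) hφB.norm_le
    dsimp only
    rw [← ofReal_norm]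
    exact ENNReal.ofReal_le_ofReal (h1.trans (le_of_eq (by ring)))
  refine (NetBigO.add (fun ε => (Real.exp_pos _).le) hneg H).mono (fun ε => ?_) fun _ => le_rfl
  rw [pairing_sub (hv ε) (hu ε)]
  refine le_trans (le_of_eq ?_) (enorm_add_le _ _)
  congr 1
  ring

end Representation

end

theorem theorem3p1 {d : ℕ} (M : WeightSequence) (Ω : TopologicalSpace.Opens (RSpace d))
    (g : GenUltradist M Ω) (hg : g.IsRegular)
    (T : UltraTest M Ω →ₗ[ℂ] ℂ) (hT : IsUltradistribution T) (hgT : g.StronglyAssociated T) :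
    ∃ f ∈ Ultradiff M Ω, ∀ φ : UltraTest M Ω, T φ = pairing f φ := by
  obtain ⟨v, hvg, hreg⟩ := hg
  obtain ⟨u, hug, hassoc⟩ := hgT
  have huv : v.1 - u.1 ∈ UltraNegligible M Ω := by
    have := (Submodule.Quotient.eq _).1 (hvg.trans hug.symm)
    exact this
  refine exists_global_representation fun K hK hKΩ =>
    exists_local_representation v.2.1 hreg hT (fun K hK hKΩ => ?_) hK hKΩ
  obtain ⟨b, hb, H⟩ := hassoc K hK hKΩ
  exact ⟨b, hb, fun φ hφ => association_of_negligible_sub u.2.1 v.2.1 huv hb.le φ (H φ hφ)⟩
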